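/- For integers $n\ge 2$, $H\ge 1$ and a number field $K$, let $\mathrm{irr}_n(H)$ be the set of monic polynomials $P=x^n+a_{n-1}x^{n-1}+\dots+a_0\in\mathbb Z[x]$ with $\max_{0\le i\le n-1}|a_i|\le H$ that are irreducible over $\mathbb Q$ and have a root in $K$, and let $\mathrm{Sub}_n(K)$ be the finite set of subfields $F\subseteq K$ with $[F:\mathbb Q]=n$. For a number field $F$ of degree $n$, let $\kappa_F$ be the residue of the Dedekind zeta function $\zeta_F$ at $s=1$, $w_F$ the number of roots of unity in $F$, $R_F$ the regulator and $D_F$ the discriminant. For each infinite place $v$ of $F$ put $m_v=1$ if $v$ is real and $m_v=2$ if $v$ is complex, let $r+1$ be the number of infinite places, and let $S_H(F)$ be the convex region $$S_H(F)=\Big\{(y_v)_v\in\mathbb R^{r+1}:\ \sum_v y_v=0,\quad -(n-1)\,m_v\log(2H)\le y_v\le m_v\log(2H)\ \text{ for all infinite places } v\Big\}$$ in the hyperplane containing the logarithmic unit lattice $\{(m_v\log|u|_v)_v: u\in\mathcal O_F^\times\}$. Its volume $\mathrm{Vol}(S_H(F))$ is the $r$-dimensional Lebesgue measure of its projection to $\mathbb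 R^r$ obtained by omitting one coordinate; in this normalization the unit lattice has covolume $R_F$, and $\mathrm{Vol}(S_H(F))=1$ if $r=0$. There are constants $C_{1,F},C_{2,F}\ge 0$, depending only on the field $F$ (not on $H$ or $K$) and effectively computable, namely $C_{i,F}=c_i(n,|D_F|)$ for two computable functions $c_1,c_2:\mathbb N\times\mathbb N\to\mathbb N$, such that for every $n\ge 2$, every number field $K$ with $\mathrm{Sub}_n(K)\ne\emptyset$ and every integer $H\ge 1$, $$\#\,\mathrm{irr}_n(H)\ \le\ \sum_{F\in\mathrm{Sub}_n(K)}\left(\kappa_F H+C_{1,F}H^{1-1/n}\right)\left(\frac{w_F}{R_F}\,\mathrm{Vol}(S_H(F))+C_{2,F}\right).$$ -/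

import Mathlib

open Polynomial MeasureTheory

/-- The height `max_{i < deg P} |a_i|` of a monic integer polynomial
`X ^ n + a_{n-1} X ^ (n-1) + ⋯ + a_0`: the leading coefficient is not taken into account. -/
def polyHeight (P : ℤ[X]) : ℕ :=
  (Finset.range P.natDegree).sup fun i => (P.coeff i).natAbs

/-- The box of monic integer polynomials of degree `n` and height at most `H`. -/
def monicBox (n H : ℕ) : Set ℤ[X] :=
  {P | P.Monic ∧ P.natDegree = n ∧ polyHeight P ≤ H}

theorem monicBox_finite (n H : ℕ) : (monicBox n H).Finite := by
  have hfin : (Set.univ.pi fun _ : Fin (n + 1) =>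
      Set.Icc (-((H : ℤ) + 1)) ((H : ℤ) + 1)).Finite :=
    Set.Finite.pi fun _ => Set.finite_Icc _ _
  refine Set.Finite.of_finite_image (f := fun P : ℤ[X] => fun i : Fin (n + 1) => P.coeff i)
    (hfin.subset ?_) ?_
  · rintro _ ⟨P, ⟨hm, hd, hh⟩, rfl⟩ i _
    rw [Set.mem_Icc, ← abs_le]
    rcases (Nat.lt_succ_iff.mp i.2).lt_or_eq with hi | hi
    · have h1 : (P.coeff i).natAbs ≤ polyHeight P :=
        Finset.le_sup (f := fun i => (P.coeff i).natAbs)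
          (Finset.mem_range.mpr (hd.symm ▸ hi))
      have h2 := h1.trans hh
      show |P.coeff i| ≤ (H : ℤ) + 1
      rw [Int.abs_eq_natAbs]
      omega
    · have h1 : P.coeff i = 1 := by rw [hi, ← hd]; exact hm
      show |P.coeff i| ≤ (H : ℤ) + 1
      rw [h1]
      simp
  · rintro P ⟨-, hP, -⟩ Q ⟨-, hQ, -⟩ h
    ext i
    by_cases hi : i < n + 1
    · exact congrFun h ⟨i, hi⟩
    · rw [coeff_eq_zero_of_natDegree_lt (by omega), coeff_eq_zero_of_natDegree_lt (by omega)]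

/-- The polynomials in the box that are irreducible over `ℚ` and have a root in `K`. -/
def irrSet (K : Type*) [Field K] [NumberField K] (n H : ℕ) : Set ℤ[X] :=
  {P | P ∈ monicBox n H ∧ Irreducible (P.map (Int.castRingHom ℚ)) ∧ ∃ x : K, aeval x P = 0}

theorem irrSet_finite (K : Type*) [Field K] [NumberField K] (n H : ℕ) :
    (irrSet K n H).Finite :=
  (monicBox_finite n H).subset fun _ hP => hP.1

/-- The number of polynomials in `irrSet K n H` (a finite set). -/
noncomputable def irrCount (K : Type*) [Field K] [NumberField K] (n H : ℕ) : ℕ :=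
  (irrSet_finite K n H).toFinset.card

theorem subfieldsOfDegree_finite (K : Type*) [Field K] [NumberField K] (n : ℕ) :
    {F : IntermediateField ℚ K | Module.finrank ℚ F = n}.Finite :=
  haveI := Field.finite_intermediateField_of_exists_primitive_element ℚ K
    (Field.exists_primitive_element ℚ K)
  Set.toFinite _

/-- The finite set of subfields of `K` of degree `n` over `ℚ`. -/
noncomputable def subfieldsOfDegree (K : Type*) [Field K] [NumberField K] (n : ℕ) :
    Finset (IntermediateField ℚ K) :=
  (subfieldsOfDegree_finite K n).toFinset

open NumberField NumberField.Units NumberField.Units.dirichletUnitTheorem in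
/-- The convex region in the space of the logarithmic unit lattice of `F` cut out by the bounds
`-(n - 1) log (2H) ≤ log |σ| ≤ log (2H)` at all infinite places, `n = [F : ℚ]`.
The ambient space is the trace-zero hyperplane of `ℝ ^ (r₁ + r₂)` (with coordinates
`mult w * log |σ_w|`, so that real places have weight `1` and complex places weight `2`),
identified with `logSpace F`, in which `unitLattice F` lives, by forgetting the coordinate at
the place `w₀`. -/
def logRegion (F : Type*) [Field F] [NumberField F] (H : ℕ) : Set (logSpace F) :=
  {x | ∃ y : InfinitePlace F → ℝ,
    ∑ w, y w = 0 ∧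
    (∀ w, -((Module.finrank ℚ F : ℝ) - 1) * (w.mult * Real.log (2 * H)) ≤ y w ∧
      y w ≤ w.mult * Real.log (2 * H)) ∧
    ∀ w, x w = y w.1}

open scoped Classical in
/-- The volume of `logRegion F H`, for the same Lebesgue measure on `logSpace F` for which the
covolume of the unit lattice is the regulator. -/
noncomputable def logRegionVolume (F : Type*) [Field F] [NumberField F] (H : ℕ) : ℝ :=
  volume.real (logRegion F H)

/-!
A root in `K` of an irreducible polynomial of degree `n` generates a subfield of degree `n`, so it
suffices to bound, for each number field `F` of degree `n`, the number of polynomials having a root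
in `F` (`irrCount_le_sum_subfields`). Such a polynomial is determined by a root, an algebraic
integer of `F` whose Mahler measure `∏ max(1, |a|_w) ^ m_w` is at most `√(n + 1) * H` by Landau's
inequality, and at most `H` if `F` has a single infinite place. These integers are counted directly
as lattice points, without passing through ideals and units.

The covering radius `ρ` of the lattice of integers is bounded in terms of the degree and the
discriminant: Minkowski's theorem gives a primitive element with bounded conjugates, and its powers
span the Minkowski space (`exists_integer_normAtPlace_sub_le`). Hence the number of lattice points
times the covolume is at most the volume of the thickened region
`∏ max(1, |x|_w - ρ) ^ m_w ≤ X` (`irrCount_mul_volume_le`). In each coordinate the thickening only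
changes the distribution function `y` into `y + O(√y)`, so that integrating out the coordinates one
by one yields, with `r + 1` infinite places, at most `X * (log X + O(1)) ^ r` times a power of `2`
and of `π` when `r ≥ 1` (`volume_mahlerRegion_le`).

On the other side, the regulator and the number of roots of unity cancel in `κ * w / R`, which is
therefore at least the density `M = 2 ^ r₁ * (2π) ^ r₂ / √|D|` of the lattice, and the volume of the
region in the logarithmic space is that of a simplex, at least `(n * log (2H)) ^ r / r!`
(`le_logRegionVolume`). For `r ≥ 1` this is at least `n * log (2H) ^ r`. As `n > √(n + 1)`, the main
term on the right exceeds `M * √(n + 1) * H * (log (2H) + b) ^ r`, and hence the count, as soon as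
`log (2H) ≥ 8 * n * b` (`sqrt_mul_pow_le_pow_div_factorial`). The finitely many smaller `H` are
absorbed by the trivial bound `(2H + 1) ^ n`. For `r = 0` the field is imaginary quadratic, and the
count is at most `M * (H + O(√H))`. All constants are explicit primitive recursive functions of `n`
and `|D|`.
-/

/-! ### Volumes of product regions -/

/-- **Layer-cake bound.** If `h ≥ 1` has distribution function at most `A * F`, the integral of a
decreasing function `φ ∘ h` over `{h ≤ Y}` is at most the Stieltjes integral of `φ` against
`A * F`, integrated by parts. The functions `ψ` and `Ψ` stand for `-φ'` and for an antiderivative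
of `ψ * F`. -/
theorem setLIntegral_comp_le_of_distribution {E : Type*} [MeasurableSpace E] (μ : Measure E)
    [SFinite μ] {h : E → ℝ} (hm : Measurable h) (h1 : ∀ x, 1 ≤ h x) {A : ENNReal} {F : ℝ → ℝ}
    (hF : ∀ y, 1 ≤ y → μ {x | h x ≤ y} ≤ A * ENNReal.ofReal (F y)) {φ ψ Ψ : ℝ → ℝ} {Y : ℝ}
    (hY : 1 ≤ Y) (hF0 : ∀ y ∈ Set.Icc 1 Y, 0 ≤ F y)
    (hφY : 0 ≤ φ Y) (hψ0 : ∀ y ∈ Set.Icc 1 Y, 0 ≤ ψ y)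
    (hψ : ContinuousOn ψ (Set.Icc 1 Y)) (hFc : ContinuousOn F (Set.Icc 1 Y))
    (hφ : ∀ y ∈ Set.Icc 1 Y, HasDerivAt φ (-ψ y) y)
    (hΨ : ∀ y ∈ Set.Icc 1 Y, HasDerivAt Ψ (ψ y * F y) y) :
    ∫⁻ x in {x | h x ≤ Y}, ENNReal.ofReal (φ (h x)) ∂μ ≤
      A * ENNReal.ofReal (φ Y * F Y + (Ψ Y - Ψ 1)) := by
  have hset : MeasurableSet {x | h x ≤ Y} := measurableSet_le hm measurable_const
  set ψ' : ℝ → ENNReal := (Set.Icc 1 Y).indicator fun y => ENNReal.ofReal (ψ y) with hψ'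
  have hψ'm : Measurable ψ' := by
    have := hψ.measurable_piecewise (g := fun _ => (0 : ℝ)) continuousOn_const measurableSet_Icc
    have h2 := this.ennreal_ofReal
    convert! h2 using 1
    ext y
    by_cases hy : y ∈ Set.Icc 1 Y <;> simp [hψ', Set.piecewise, hy]
  have key : ∀ t ∈ Set.Icc 1 Y, ENNReal.ofReal (φ t) =
      ENNReal.ofReal (φ Y) + ∫⁻ y in Set.Ioc t Y, ψ' y := by
    intro t ht
    have hsub : Set.Icc t Y ⊆ Set.Icc 1 Y := Set.Icc_subset_Icc_left ht.1
    have hint : IntervalIntegrable ψ volume t Y :=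
      (hψ.mono (by rw [Set.uIcc_of_le ht.2]; exact hsub)).intervalIntegrable
    have e1 : ∫ y in t..Y, ψ y = φ t - φ Y := by
      have := intervalIntegral.integral_eq_sub_of_hasDerivAt (f := fun y => -φ y) (f' := ψ)
        (a := t) (b := Y) (fun y hy => by
          rw [Set.uIcc_of_le ht.2] at hy
          simpa using! (hφ y (hsub hy)).neg) hint
      rw [this]; ring
    have e2 : ∫⁻ y in Set.Ioc t Y, ψ' y = ENNReal.ofReal (∫ y in t..Y, ψ y) := by
      rw [intervalIntegral.integral_of_le ht.2, ofReal_integral_eq_lintegral_ofReal]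
      · refine setLIntegral_congr_fun measurableSet_Ioc fun y hy => ?_
        simp only [hψ']
        rw [Set.indicator_of_mem (hsub (Set.Ioc_subset_Icc_self hy))]
      · exact (intervalIntegrable_iff_integrableOn_Ioc_of_le ht.2).1 hint
      · exact (ae_restrict_iff' measurableSet_Ioc).2
          (.of_forall fun y hy => hψ0 y (hsub (Set.Ioc_subset_Icc_self hy)))
    rw [e2, ← ENNReal.ofReal_add hφY, e1]
    · congr 1; ring
    · rw [intervalIntegral.integral_of_le ht.2]
      exact setIntegral_nonneg measurableSet_Ioc
        fun y hy => hψ0 y (hsub (Set.Ioc_subset_Icc_self hy))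
  have hYI : Y ∈ Set.Icc 1 Y := ⟨hY, le_rfl⟩
  calc ∫⁻ x in {x | h x ≤ Y}, ENNReal.ofReal (φ (h x)) ∂μ
      = ∫⁻ x in {x | h x ≤ Y}, (ENNReal.ofReal (φ Y) + ∫⁻ y in Set.Ioc (h x) Y, ψ' y) ∂μ :=
        setLIntegral_congr_fun hset fun x hx => key _ ⟨h1 x, hx⟩
    _ = ENNReal.ofReal (φ Y) * μ {x | h x ≤ Y} +
        ∫⁻ x in {x | h x ≤ Y}, (∫⁻ y in Set.Ioc (h x) Y, ψ' y) ∂μ := by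
        rw [lintegral_add_left measurable_const, setLIntegral_const]
    _ ≤ ENNReal.ofReal (φ Y) * μ {x | h x ≤ Y} +
        ∫⁻ x, (∫⁻ y, {p : E × ℝ | h p.1 < p.2 ∧ p.2 ≤ Y}.indicator (fun p => ψ' p.2) (x, y)) ∂μ := by
        refine add_le_add le_rfl ?_
        refine (setLIntegral_le_lintegral _ _).trans (lintegral_mono fun x => ?_)
        rw [← lintegral_indicator measurableSet_Ioc]
        refine lintegral_mono fun y => ?_
        by_cases hy : y ∈ Set.Ioc (h x) Y
        · simp [Set.indicator, hy.1, hy.2]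
        · rw [Set.indicator_of_notMem hy]; exact zero_le
    _ = ENNReal.ofReal (φ Y) * μ {x | h x ≤ Y} +
        ∫⁻ y, (∫⁻ x, {p : E × ℝ | h p.1 < p.2 ∧ p.2 ≤ Y}.indicator (fun p => ψ' p.2) (x, y) ∂μ) := by
        rw [lintegral_lintegral_swap]
        refine Measurable.aemeasurable ?_
        refine Measurable.indicator (hψ'm.comp measurable_snd) ?_
        exact (measurableSet_lt (hm.comp measurable_fst) measurable_snd).inter
          (measurableSet_le measurable_snd measurable_const)
    _ ≤ ENNReal.ofReal (φ Y) * (A * ENNReal.ofReal (F Y)) +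
        ∫⁻ y in Set.Ioc 1 Y, A * ENNReal.ofReal (ψ y * F y) := by
        refine add_le_add (by gcongr; exact hF Y hY) ?_
        rw [← lintegral_indicator measurableSet_Ioc]
        refine lintegral_mono fun y => ?_
        by_cases hy : y ∈ Set.Ioc 1 Y
        · rw [Set.indicator_of_mem hy]
          have hy' := Set.Ioc_subset_Icc_self hy
          calc _ ≤ ∫⁻ x, {x | h x ≤ y}.indicator (fun _ => ENNReal.ofReal (ψ y)) x ∂μ := by
                refine lintegral_mono fun x => ?_
                by_cases hx : h x < y
                · simp [Set.indicator, hψ', hx, hx.le, hy.2, hy'.1]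
                · rw [Set.indicator_of_notMem (fun hh => hx hh.1)]; exact zero_le
            _ = ENNReal.ofReal (ψ y) * μ {x | h x ≤ y} := by
                rw [lintegral_indicator_const (measurableSet_le hm measurable_const)]
            _ ≤ ENNReal.ofReal (ψ y) * (A * ENNReal.ofReal (F y)) := by
                gcongr; exact hF y hy.1.le
            _ = A * ENNReal.ofReal (ψ y * F y) := by
                rw [ENNReal.ofReal_mul (hψ0 y hy')]; ring
        · rw [Set.indicator_of_notMem hy]
          refine le_of_eq_of_le (lintegral_congr fun x => ?_) (lintegral_zero (μ := μ)).le
          exact Set.indicator_of_notMem (fun hh => hy ⟨(h1 x).trans_lt hh.1, hh.2⟩) _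
    _ = A * ENNReal.ofReal (φ Y * F Y + (Ψ Y - Ψ 1)) := by
        have hc : ContinuousOn (fun y => ψ y * F y) (Set.Icc 1 Y) := hψ.mul hFc
        have hint : IntervalIntegrable (fun y => ψ y * F y) volume 1 Y :=
          (hc.mono (by rw [Set.uIcc_of_le hY])).intervalIntegrable
        have h0 : ∀ y ∈ Set.Ioc 1 Y, 0 ≤ ψ y * F y := fun y hy =>
          mul_nonneg (hψ0 y (Set.Ioc_subset_Icc_self hy)) (hF0 y (Set.Ioc_subset_Icc_self hy))
        have e1 : ∫ y in (1:ℝ)..Y, ψ y * F y = Ψ Y - Ψ 1 :=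
          intervalIntegral.integral_eq_sub_of_hasDerivAt
            (fun y hy => hΨ y (by rwa [Set.uIcc_of_le hY] at hy)) hint
        have hm2 : AEMeasurable (fun y => ENNReal.ofReal (ψ y * F y))
            (volume.restrict (Set.Ioc 1 Y)) :=
          ((hc.mono Set.Ioc_subset_Icc_self).aemeasurable measurableSet_Ioc).ennreal_ofReal
        rw [lintegral_const_mul'' _ hm2, ← ofReal_integral_eq_lintegral_ofReal
          ((intervalIntegrable_iff_integrableOn_Ioc_of_le hY).1 hint)
          ((ae_restrict_iff' measurableSet_Ioc).2 (.of_forall h0)),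
          ← intervalIntegral.integral_of_le hY, e1, ENNReal.ofReal_add
            (mul_nonneg hφY (hF0 Y hYI)), ENNReal.ofReal_mul hφY]
        · ring
        · rw [← e1, intervalIntegral.integral_of_le hY]
          exact setIntegral_nonneg measurableSet_Ioc h0

/-- A bound for the measure of `{h₁ * ⋯ * h_k ≤ Y}` in a product of `k` spaces on each of which
`h_i ≥ 1` has distribution function at most `y + C √y`. For `k ≥ 2` the leading coefficient
is `1`, whatever the size of `C`. -/
noncomputable def prodVolBound (C : ℝ) : ℕ → ℝ → ℝ
  | 0, _ => 1
  | 1, Y => Y + C * √Y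
  | k + 2, Y => Y * (Real.log Y + (1 + 5 * C + 2 * C ^ 2)) ^ (k + 1)

open Classical in
/-- The bound `prodVolBound`, as an extended nonnegative real, extended by zero to `Y < 1`. -/
noncomputable def prodVolBound' (C : ℝ) (k : ℕ) (Y : ℝ) : ENNReal :=
  if 1 ≤ Y then ENNReal.ofReal (prodVolBound C k Y) else 0

theorem measurable_prodVolBound (C : ℝ) (k : ℕ) : Measurable (prodVolBound C k) := by
  match k with
  | 0 => exact measurable_const
  | 1 => unfold prodVolBound; fun_prop
  | k + 2 => unfold prodVolBound; fun_prop

theorem measurable_prodVolBound' (C : ℝ) (k : ℕ) : Measurable (prodVolBound' C k) :=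
  Measurable.ite (measurableSet_le measurable_const measurable_id)
    (measurable_prodVolBound C k).ennreal_ofReal measurable_const

theorem setLIntegral_inv_le_of_distribution {E : Type*} [MeasurableSpace E] (μ : Measure E)
    [SFinite μ] {h : E → ℝ} (hm : Measurable h) (h1 : ∀ x, 1 ≤ h x) {A : ENNReal} {C : ℝ}
    (hC : 0 ≤ C) (hF : ∀ y, 1 ≤ y → μ {x | h x ≤ y} ≤ A * ENNReal.ofReal (y + C * √y))
    {Y : ℝ} (hY : 1 ≤ Y) :
    ∫⁻ x in {x | h x ≤ Y}, ENNReal.ofReal (h x)⁻¹ ∂μ ≤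
      A * ENNReal.ofReal (Real.log Y + (1 + 3 * C)) := by
  have hpos : ∀ y ∈ Set.Icc 1 Y, 0 < y := fun y hy => zero_lt_one.trans_le hy.1
  refine (setLIntegral_comp_le_of_distribution μ hm h1 hF (φ := fun y => y⁻¹)
    (ψ := fun y => (y ^ 2)⁻¹) (Ψ := fun y => Real.log y - 2 * C * (√y)⁻¹) hY
    (fun y hy => by have := hpos y hy; positivity) (by positivity)
    (fun y hy => by positivity) ?_ (by fun_prop) ?_ ?_).trans ?_
  · exact ContinuousOn.inv₀ (by fun_prop) fun y hy => (pow_pos (hpos y hy) 2).ne'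
  · intro y hy
    simpa using hasDerivAt_inv (hpos y hy).ne'
  · intro y hy
    have hy0 := hpos y hy
    have hs : 0 < √y := Real.sqrt_pos.2 hy0
    have hd := (Real.hasDerivAt_log hy0.ne').sub
      (((Real.hasDerivAt_sqrt hy0.ne').inv hs.ne').const_mul (2 * C))
    convert! hd using 1
    have e : √y ^ 2 = y := Real.sq_sqrt hy0.le
    rw [e]
    field_simp
    linear_combination C * e
  · refine mul_le_mul_right (ENNReal.ofReal_le_ofReal ?_) _
    have hY0 : 0 < Y := by linarith
    have hs : 0 < √Y := Real.sqrt_pos.2 hY0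
    have hs1 : 1 ≤ √Y := Real.one_le_sqrt.2 hY
    have e : √Y ^ 2 = Y := Real.sq_sqrt hY0.le
    have e1 : Y⁻¹ * (Y + C * √Y) = 1 + C * (√Y)⁻¹ := by
      field_simp
      linear_combination C * e
    simp only [e1, Real.sqrt_one, Real.log_one]
    have : 0 ≤ C * (√Y)⁻¹ := by positivity
    linarith

theorem setLIntegral_inv_sqrt_le_of_distribution {E : Type*} [MeasurableSpace E] (μ : Measure E)
    [SFinite μ] {h : E → ℝ} (hm : Measurable h) (h1 : ∀ x, 1 ≤ h x) {A : ENNReal} {C : ℝ}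
    (hC : 0 ≤ C) (hF : ∀ y, 1 ≤ y → μ {x | h x ≤ y} ≤ A * ENNReal.ofReal (y + C * √y))
    {Y : ℝ} (hY : 1 ≤ Y) :
    ∫⁻ x in {x | h x ≤ Y}, ENNReal.ofReal (√(h x))⁻¹ ∂μ ≤
      A * ENNReal.ofReal ((2 + 2 * C) * √Y) := by
  have hpos : ∀ y ∈ Set.Icc 1 Y, 0 < y := fun y hy => zero_lt_one.trans_le hy.1
  refine (setLIntegral_comp_le_of_distribution μ hm h1 hF (φ := fun y => (√y)⁻¹)
    (ψ := fun y => (2 * y * √y)⁻¹) (Ψ := fun y => √y + C / 2 * Real.log y) hY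
    (fun y hy => by have := hpos y hy; positivity) (by positivity)
    (fun y hy => by have := hpos y hy; positivity) ?_ (by fun_prop) ?_ ?_).trans ?_
  · refine ContinuousOn.inv₀ (by fun_prop) fun y hy => ?_
    have := hpos y hy
    positivity
  · intro y hy
    have hy0 := hpos y hy
    have hs : 0 < √y := Real.sqrt_pos.2 hy0
    convert! (Real.hasDerivAt_sqrt hy0.ne').inv hs.ne' using 1
    have e : √y ^ 2 = y := Real.sq_sqrt hy0.le
    rw [e]
    field_simp
  · intro y hy
    have hy0 := hpos y hy
    have hs : 0 < √y := Real.sqrt_pos.2 hy0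
    convert! (Real.hasDerivAt_sqrt hy0.ne').add
      ((Real.hasDerivAt_log hy0.ne').const_mul (C / 2)) using 1
    field_simp
  · refine mul_le_mul_right (ENNReal.ofReal_le_ofReal ?_) _
    have hY0 : 0 < Y := by linarith
    have hs : 0 < √Y := Real.sqrt_pos.2 hY0
    have e : √Y ^ 2 = Y := Real.sq_sqrt hY0.le
    have e1 : (√Y)⁻¹ * (Y + C * √Y) = √Y + C := by
      field_simp
      linear_combination -e
    have hl : Real.log Y ≤ 2 * (√Y - 1) := by
      have := Real.log_le_sub_one_of_pos hs
      rw [Real.log_sqrt hY0.le] at this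
      linarith
    simp only [e1, Real.sqrt_one, Real.log_one]
    nlinarith [mul_le_mul_of_nonneg_left hl hC]

/-- Adding one factor to the product increases the index of the bound by one. -/
theorem lintegral_prodVolBound'_div_le {E : Type*} [MeasurableSpace E] (μ : Measure E)
    [SFinite μ] {h : E → ℝ} (hm : Measurable h) (h1 : ∀ x, 1 ≤ h x) {A : ENNReal} {C : ℝ}
    (hC : 0 ≤ C) (hF : ∀ y, 1 ≤ y → μ {x | h x ≤ y} ≤ A * ENNReal.ofReal (y + C * √y))
    (k : ℕ) (Y : ℝ) :
    ∫⁻ x, prodVolBound' C k (Y / h x) ∂μ ≤ A * prodVolBound' C (k + 1) Y := by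
  have hpos : ∀ x, 0 < h x := fun x => zero_lt_one.trans_le (h1 x)
  have hiff : ∀ x, 1 ≤ Y / h x ↔ h x ≤ Y := fun x => by rw [le_div_iff₀ (hpos x), one_mul]
  have hset : MeasurableSet {x | h x ≤ Y} := measurableSet_le hm measurable_const
  by_cases hY : 1 ≤ Y
  swap
  · have : ∀ x, prodVolBound' C k (Y / h x) = 0 := fun x => by
      rw [prodVolBound', if_neg]
      rw [hiff]
      exact fun hh => hY ((h1 x).trans hh)
    simp [this]
  have hY0 : 0 < Y := by linarith
  have hs : 0 < √Y := Real.sqrt_pos.2 hY0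
  have hlog : 0 ≤ Real.log Y := Real.log_nonneg hY
  have hind : ∫⁻ x, prodVolBound' C k (Y / h x) ∂μ =
      ∫⁻ x in {x | h x ≤ Y}, ENNReal.ofReal (prodVolBound C k (Y / h x)) ∂μ := by
    rw [← lintegral_indicator hset]
    refine lintegral_congr fun x => ?_
    by_cases hx : h x ≤ Y
    · simp [Set.indicator, prodVolBound', (hiff x).2 hx, hx]
    · simp [Set.indicator, prodVolBound', mt (hiff x).1 hx, hx]
  rw [hind, prodVolBound', if_pos hY]
  have hJ := setLIntegral_inv_le_of_distribution μ hm h1 hC hF hY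
  match k with
  | 0 =>
    simpa [prodVolBound] using hF Y hY
  | 1 =>
    have hJ' := setLIntegral_inv_sqrt_le_of_distribution μ hm h1 hC hF hY
    have e : ∀ x, ENNReal.ofReal (prodVolBound C 1 (Y / h x)) =
        ENNReal.ofReal Y * ENNReal.ofReal (h x)⁻¹ +
          ENNReal.ofReal (C * √Y) * ENNReal.ofReal (√(h x))⁻¹ := fun x => by
      have := hpos x
      rw [prodVolBound, Real.sqrt_div' _ this.le, ENNReal.ofReal_add (by positivity)
        (by positivity), ← ENNReal.ofReal_mul hY0.le, ← ENNReal.ofReal_mul (by positivity)]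
      simp only [div_eq_mul_inv, mul_assoc]
    simp only [e]
    rw [lintegral_add_left (by fun_prop), lintegral_const_mul _ (by fun_prop),
      lintegral_const_mul _ (by fun_prop)]
    calc _ ≤ ENNReal.ofReal Y * (A * ENNReal.ofReal (Real.log Y + (1 + 3 * C))) +
          ENNReal.ofReal (C * √Y) * (A * ENNReal.ofReal ((2 + 2 * C) * √Y)) := by gcongr
      _ = A * ENNReal.ofReal (Y * (Real.log Y + (1 + 3 * C)) +
          C * √Y * ((2 + 2 * C) * √Y)) := by
        rw [ENNReal.ofReal_add (p := Y * _) (by positivity) (by positivity),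
          ENNReal.ofReal_mul hY0.le, ENNReal.ofReal_mul (p := C * √Y) (by positivity)]
        ring
      _ = _ := by
        congr 2
        have e : √Y ^ 2 = Y := Real.sq_sqrt hY0.le
        simp only [prodVolBound]
        linear_combination (C * (2 + 2 * C)) * e
  | k + 2 =>
    set a := 1 + 5 * C + 2 * C ^ 2 with ha
    have ha0 : 0 ≤ a := by positivity
    calc _ ≤ ∫⁻ x in {x | h x ≤ Y}, ENNReal.ofReal (Y * (Real.log Y + a) ^ (k + 1)) *
          ENNReal.ofReal (h x)⁻¹ ∂μ := by
          refine setLIntegral_mono (by fun_prop) fun x hx => ?_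
          rw [← ENNReal.ofReal_mul (by positivity)]
          gcongr
          have hp := hpos x
          have hl0 : 0 ≤ Real.log (Y / h x) := Real.log_nonneg ((hiff x).2 hx)
          have hl : Real.log (Y / h x) ≤ Real.log Y := by
            gcongr
            exact div_le_self hY0.le (h1 x)
          simp only [prodVolBound]
          rw [← ha, div_mul_eq_mul_div, div_eq_mul_inv]
          gcongr
      _ = ENNReal.ofReal (Y * (Real.log Y + a) ^ (k + 1)) *
          ∫⁻ x in {x | h x ≤ Y}, ENNReal.ofReal (h x)⁻¹ ∂μ :=
          lintegral_const_mul _ (by fun_prop)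
      _ ≤ ENNReal.ofReal (Y * (Real.log Y + a) ^ (k + 1)) *
          (A * ENNReal.ofReal (Real.log Y + (1 + 3 * C))) := by gcongr
      _ ≤ ENNReal.ofReal (Y * (Real.log Y + a) ^ (k + 1)) *
          (A * ENNReal.ofReal (Real.log Y + a)) := by
          gcongr
          nlinarith
      _ = A * ENNReal.ofReal (prodVolBound C (k + 2 + 1) Y) := by
          rw [mul_left_comm, ← ENNReal.ofReal_mul (by positivity)]
          simp only [prodVolBound]
          rw [← ha]
          congr 2
          ring

/-- The bound for a finite power of a measure space, obtained by integrating out the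
coordinates one at a time. -/
theorem lintegral_pi_prodVolBound'_div_prod_le {E : Type*} [MeasurableSpace E] (μ : Measure E)
    [SigmaFinite μ] {h : E → ℝ} (hm : Measurable h) (h1 : ∀ x, 1 ≤ h x) {A : ENNReal} {C : ℝ}
    (hC : 0 ≤ C) (hF : ∀ y, 1 ≤ y → μ {x | h x ≤ y} ≤ A * ENNReal.ofReal (y + C * √y))
    {κ : Type*} [Fintype κ] (k : ℕ)
    (Y : ℝ) : ∫⁻ x, prodVolBound' C k (Y / ∏ i, h (x i)) ∂(Measure.pi fun _ : κ => μ) ≤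
      A ^ Fintype.card κ * prodVolBound' C (k + Fintype.card κ) Y := by
  classical
  have hG := measurable_prodVolBound' C
  have main : ∀ (s : Finset κ) (Y : ℝ) (x : κ → E),
      (∫⋯∫⁻_s, (fun x => prodVolBound' C k (Y / ∏ i ∈ s, h (x i))) ∂fun _ => μ) x ≤
        A ^ s.card * prodVolBound' C (k + s.card) Y := by
    intro s
    induction s using Finset.induction_on with
    | empty => intro Y x; simp
    | insert i s hi ih =>
      intro Y x
      have hmeas : ∀ s : Finset κ, Measurable
          fun x : κ → E => prodVolBound' C k (Y / ∏ i ∈ s, h (x i)) := fun s =>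
        (hG k).comp (measurable_const.div
          (Finset.measurable_prod _ fun i _ => hm.comp (measurable_pi_apply i)))
      rw [lmarginal_insert _ (hmeas _) hi]
      have : ∀ t : E, (∫⋯∫⁻_s, (fun x => prodVolBound' C k
            (Y / ∏ i ∈ insert i s, h (x i))) ∂fun _ => μ) (Function.update x i t) ≤
          A ^ s.card * prodVolBound' C (k + s.card) (Y / h t) := by
        intro t
        refine le_of_eq_of_le ?_ (ih (Y / h t) (Function.update x i t))
        refine lintegral_congr fun z => ?_
        beta_reduce
        rw [Finset.prod_insert hi, div_div, Function.updateFinset, dif_neg hi,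
          Function.update_self]
      refine (lintegral_mono this).trans ?_
      rw [lintegral_const_mul _ (show Measurable fun t => prodVolBound' C (k + s.card) (Y / h t) from
          (hG _).comp (measurable_const.div hm)),
        Finset.card_insert_of_notMem hi, pow_succ, mul_assoc, ← add_assoc]
      gcongr
      exact lintegral_prodVolBound'_div_le μ hm h1 hC hF _ _
  by_cases hE : Nonempty (κ → E)
  · obtain ⟨x⟩ := hE
    have := main Finset.univ Y x
    rw [lmarginal_univ, Finset.card_univ] at this
    exact this
  · rw [not_nonempty_iff] at hE
    simp

/-! ### The volume of the logarithmic region -/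

/-- The simplex `{z ≥ 0, ∑ z ≤ s}` has volume at least `s ^ k / k!`: its images under the `2 ^ k`
sign changes cover the cross-polytope. -/
theorem ofReal_pow_div_factorial_le_volume_simplex {ι : Type*} [Fintype ι] {s : ℝ} (hs : 0 ≤ s) :
    ENNReal.ofReal (s ^ Fintype.card ι / (Fintype.card ι).factorial) ≤
      volume {z : ι → ℝ | (∀ i, 0 ≤ z i) ∧ ∑ i, z i ≤ s} := by
  classical
  rcases isEmpty_or_nonempty ι with hι | hι
  · have : {z : ι → ℝ | (∀ i, 0 ≤ z i) ∧ ∑ i, z i ≤ s} = Set.univ := by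
      ext z; simp [hs]
    rw [this, volume_pi, Measure.pi_univ]
    simp
  set S := {z : ι → ℝ | (∀ i, 0 ≤ z i) ∧ ∑ i, z i ≤ s} with hS
  have hSm : MeasurableSet S := by
    have : S = (⋂ i, {z : ι → ℝ | 0 ≤ z i}) ∩ {z | ∑ i, z i ≤ s} := by
      ext z; simp [hS]
    rw [this]
    exact (MeasurableSet.iInter fun i => measurableSet_le measurable_const
      (measurable_pi_apply i)).inter (measurableSet_le
      (Finset.measurable_sum _ fun i _ => measurable_pi_apply i) measurable_const)
  -- `R e` changes the sign of the coordinates in `e`.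
  let R : Finset ι → (ι → ℝ) → (ι → ℝ) := fun e x i => (if i ∈ e then Neg.neg else id) (x i)
  have hR : ∀ e, MeasurePreserving (R e) volume volume := fun e => by
    refine volume_preserving_pi (f := fun i => if i ∈ e then Neg.neg else id) fun i => ?_
    split_ifs
    · exact Measure.measurePreserving_neg volume
    · exact MeasurePreserving.id volume
  have hcov : {x : ι → ℝ | (∑ i, |x i| ^ (1 : ℝ)) ^ (1 / (1 : ℝ)) < s} ⊆
      ⋃ e ∈ (Finset.univ : Finset (Finset ι)), R e ⁻¹' S := by
    intro x hx
    simp only [Real.rpow_one, div_one, Set.mem_ofPred_eq] at hx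
    have hRx : ∀ i, R (Finset.univ.filter fun i => x i < 0) x i = |x i| := fun i => by
      by_cases hi : x i < 0
      · simp [R, hi, abs_of_neg]
      · simp [R, hi, abs_of_nonneg (not_lt.1 hi)]
    refine Set.mem_iUnion₂.2 ⟨Finset.univ.filter fun i => x i < 0, Finset.mem_univ _, ?_, ?_⟩
    · intro i; rw [hRx]; exact abs_nonneg _
    · simp only [hRx]; exact hx.le
  have hvol := volume_sum_rpow_lt ι (p := 1) le_rfl s
  have hle : ENNReal.ofReal s ^ Fintype.card ι * ENNReal.ofReal
      ((2 * Real.Gamma (1 / 1 + 1)) ^ Fintype.card ι / Real.Gamma (Fintype.card ι / 1 + 1)) ≤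
      2 ^ Fintype.card ι * volume S := by
    rw [← hvol]
    refine (measure_mono hcov).trans ((measure_biUnion_finset_le _ _).trans ?_)
    simp only [fun e => (hR e).measure_preimage hSm.nullMeasurableSet]
    simp
  have e1 : (2 * Real.Gamma (1 / 1 + 1)) ^ Fintype.card ι / Real.Gamma (Fintype.card ι / 1 + 1) =
      2 ^ Fintype.card ι * (1 / (Fintype.card ι).factorial) := by
    rw [div_one, div_one, Real.Gamma_nat_eq_factorial]
    norm_num
    rfl
  rw [e1, ENNReal.ofReal_mul (by positivity), ENNReal.ofReal_pow zero_le_two,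
    ENNReal.ofReal_ofNat, mul_left_comm] at hle
  have := (ENNReal.mul_le_mul_iff_right (by simp) (by simp)).1 hle
  rwa [← ENNReal.ofReal_pow hs, ← ENNReal.ofReal_mul (by positivity), mul_one_div] at this

open NumberField NumberField.Units NumberField.Units.dirichletUnitTheorem in
/-- In the coordinates `z_w = mult w * log (2H) - y_w ≥ 0` the region `logRegion F H` is a simplex:
its lower bounds on `y_w` follow from the upper ones and `∑ y_w = 0`. -/
theorem le_logRegionVolume (F : Type*) [Field F] [NumberField F] {H : ℕ} (hH : 1 ≤ H) :
    (Module.finrank ℚ F * Real.log (2 * H)) ^ rank F / (rank F).factorial ≤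
      logRegionVolume F H := by
  classical
  set n : ℝ := (Module.finrank ℚ F : ℝ) with hn
  set L := Real.log (2 * H) with hL
  have hH' : (1 : ℝ) ≤ H := by exact_mod_cast hH
  have hL0 : 0 ≤ L := Real.log_nonneg (by linarith)
  have hn0 : 0 ≤ n := Nat.cast_nonneg _
  have hcard : Fintype.card {w : InfinitePlace F // w ≠ w₀} = rank F := by
    rw [rank, Fintype.card_subtype_compl, Fintype.card_subtype_eq]
  have hmult : ∀ w : InfinitePlace F, (1 : ℝ) ≤ w.mult := fun w => by
    exact_mod_cast w.mult_pos
  have hsum : ∑ w : InfinitePlace F, (w.mult : ℝ) = n := by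
    rw [hn, ← InfinitePlace.sum_mult_eq]; push_cast; rfl
  have hsplit : ∀ f : InfinitePlace F → ℝ, ∑ w, f w =
      f w₀ + ∑ w : {w : InfinitePlace F // w ≠ w₀}, f w.1 := fun f => by
    rw [Fintype.sum_eq_add_sum_subtype_ne f w₀]
  set c : logSpace F := fun w => w.1.mult * L with hc
  have hsub : (fun x => c - x) ⁻¹' {z | (∀ i, 0 ≤ z i) ∧ ∑ i, z i ≤ n * L} ⊆ logRegion F H := by
    rintro x ⟨hx0, hxs⟩
    set y : InfinitePlace F → ℝ := fun w => if h : w ≠ w₀ then x ⟨w, h⟩ else -∑ w, x w with hy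
    have hyw : ∀ w : {w : InfinitePlace F // w ≠ w₀}, y w.1 = x w := fun w => by
      simp only [hy, dif_pos w.2]
    have hyw₀ : y w₀ = -∑ w, x w := by simp [hy]
    have hcs : ∑ w, c w = n * L - (w₀ : InfinitePlace F).mult * L := by
      rw [← hsum, Finset.sum_mul, hsplit fun w => (w.mult : ℝ) * L]; ring
    simp only [Pi.sub_apply, Finset.sum_sub_distrib, hcs] at hxs
    have hzsum : ∑ w, (c - x) w = n * L - (w₀ : InfinitePlace F).mult * L - ∑ w, x w := by
      simp [Finset.sum_sub_distrib, hcs]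
    have hbd : ∀ w, w.mult * L - n * L ≤ y w ∧ y w ≤ w.mult * L := by
      intro w
      by_cases hw : w = w₀
      · subst hw
        rw [hyw₀]
        have := Finset.sum_nonneg fun w (_ : w ∈ Finset.univ) => hx0 w
        rw [hzsum] at this
        constructor <;> linarith
      · have h0 := hx0 ⟨w, hw⟩
        have h1 := Finset.single_le_sum (fun w _ => hx0 w) (Finset.mem_univ ⟨w, hw⟩)
        rw [hzsum] at h1
        have := hyw ⟨w, hw⟩
        simp only [Pi.sub_apply, hc] at h0 h1
        simp only at this
        rw [this]
        constructor <;> linarith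
    refine ⟨y, ?_, fun w => ⟨?_, (hbd w).2⟩, fun w => (hyw w).symm⟩
    · rw [hsplit, hyw₀]; simp [hyw]
    · refine le_trans ?_ (hbd w).1
      nlinarith [mul_le_mul_of_nonneg_right (hmult w) (mul_nonneg hn0 hL0)]
  -- The real-valued volume of an unbounded region could be the junk value `0`.
  have hfin : volume (logRegion F H) ≠ ⊤ := by
    refine ((measure_mono (t := Set.Icc (fun w : {w : InfinitePlace F // w ≠ w₀} =>
      -(n - 1) * (w.1.mult * L)) c) ?_).trans_lt isCompact_Icc.measure_lt_top).ne
    rintro x ⟨y, -, hy, hxy⟩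
    exact ⟨fun w => by rw [hxy]; exact (hy w.1).1, fun w => by rw [hxy]; exact (hy w.1).2⟩
  have hpre : volume ((fun x => c - x) ⁻¹' {z | (∀ i, 0 ≤ z i) ∧ ∑ i, z i ≤ n * L}) =
      volume {z : logSpace F | (∀ i, 0 ≤ z i) ∧ ∑ i, z i ≤ n * L} := by
    have hmp := Measure.measurePreserving_sub_left (volume : Measure (logSpace F)) c
    exact hmp.measure_preimage_equiv (f := MeasurableEquiv.subLeft c) _
  have hkey := (ofReal_pow_div_factorial_le_volume_simplex
    (ι := {w : InfinitePlace F // w ≠ w₀}) (mul_nonneg hn0 hL0)).trans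
    (hpre.symm.le.trans (measure_mono hsub))
  rw [hcard] at hkey
  rw [logRegionVolume, measureReal_def]
  have := (ENNReal.ofReal_le_iff_le_toReal hfin).1 hkey
  convert this

/-! ### The covering radius of the lattice of integers -/

section Covering

open NumberField NumberField.InfinitePlace NumberField.mixedEmbedding Module
open scoped NNReal ENNReal IntermediateField

variable (F : Type*) [Field F] [NumberField F]

theorem minkowskiBound_one_lt :
    minkowskiBound F ↑1 < ((2 ^ finrank ℚ F * ((discr F).natAbs + 1) : ℕ) : ℝ≥0) := by
  rw [minkowskiBound, volume_fundamentalDomain_fractionalIdealLatticeBasis,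
    Units.val_one, FractionalIdeal.absNorm_one, Rat.cast_one,
    ENNReal.ofReal_one, one_mul, mixedEmbedding.finrank, volume_fundamentalDomain_latticeBasis]
  have h1 : (2 : ℝ≥0∞)⁻¹ ^ nrComplexPlaces F ≤ 1 := pow_le_one₀ (by positivity) (by simp)
  have h2 : NNReal.sqrt ‖discr F‖₊ < ((discr F).natAbs + 1 : ℕ) := by
    rw [← NNReal.coe_lt_coe, Real.coe_sqrt, Real.sqrt_lt' (by positivity)]
    push_cast
    rw [Int.norm_eq_abs, ← Int.cast_abs, ← Nat.cast_natAbs]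
    nlinarith [Nat.cast_nonneg (α := ℝ) (discr F).natAbs]
  calc _ ≤ 1 * (NNReal.sqrt ‖discr F‖₊ : ℝ≥0∞) * 2 ^ finrank ℚ F := by gcongr
    _ < (((discr F).natAbs + 1 : ℕ) : ℝ≥0) * 2 ^ finrank ℚ F := by
      rw [one_mul]
      refine ENNReal.mul_lt_mul_left (by simp) (by simp) ?_
      exact ENNReal.coe_lt_coe.2 h2
    _ = _ := by push_cast; ring

/-- Minkowski's theorem provides a primitive element all of whose conjugates are bounded in terms
of the degree and the discriminant. -/
theorem exists_primitive_element_le :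
    ∃ a : 𝓞 F, ℚ⟮(a : F)⟯ = ⊤ ∧ ∀ w : InfinitePlace F,
      w a ≤ 2 ^ finrank ℚ F * ((discr F).natAbs + 1) + 1 := by
  set B : ℕ := 2 ^ finrank ℚ F * ((discr F).natAbs + 1) with hB
  have hlt : minkowskiBound F ↑1 < ((B : ℝ≥0) : ℝ≥0∞) := minkowskiBound_one_lt F
  have hBc : (2 : ℝ) ^ finrank ℚ F * ((discr F).natAbs + 1) + 1 = B + 1 := by
    rw [hB]; push_cast; rfl
  rw [hBc]
  have hB0 : (0 : ℝ) ≤ B := Nat.cast_nonneg _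
  obtain ⟨w₀⟩ : Nonempty (InfinitePlace F) := inferInstance
  rcases w₀.isReal_or_isComplex with hw | hw
  · have : minkowskiBound F ↑1 < convexBodyLTFactor F * (B : ℝ≥0) := hlt.trans_le <| by
      refine le_mul_of_one_le_left' ?_
      exact_mod_cast one_le_convexBodyLTFactor F
    obtain ⟨a, ha, hb⟩ := exists_primitive_element_lt_of_isReal F hw this
    refine ⟨a, ha, fun w => (hb w).le.trans ?_⟩
    simp only [NNReal.coe_max, NNReal.coe_natCast, NNReal.coe_one]
    exact max_le (by linarith) (by linarith)
  · have : minkowskiBound F ↑1 < convexBodyLT'Factor F * (B : ℝ≥0) := hlt.trans_le <| by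
      refine le_mul_of_one_le_left' ?_
      exact_mod_cast one_le_convexBodyLT'Factor F
    obtain ⟨a, ha, hb⟩ := exists_primitive_element_lt_of_isComplex F hw this
    refine ⟨a, ha, fun w => (hb w).le.trans ?_⟩
    rw [Real.sqrt_le_left (by positivity)]
    simp only [NNReal.coe_natCast]
    nlinarith

theorem span_real_mixedEmbedding_pow_eq_top {a : F} (ha : ℚ⟮a⟯ = ⊤) :
    Submodule.span ℝ (Set.range fun i : Fin (finrank ℚ F) => mixedEmbedding F (a ^ (i : ℕ))) =
      ⊤ := by
  rw [eq_top_iff, ← (latticeBasis F).span_eq, Submodule.span_le]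
  rintro _ ⟨j, rfl⟩
  rw [latticeBasis_apply]
  have hint : IsIntegral ℚ a := .of_finite ℚ a
  obtain ⟨c, hc⟩ : ∃ c : Fin (finrank ℚ F) → ℚ,
      integralBasis F j = ∑ i, c i • a ^ (i : ℕ) := by
    have hdeg := (Field.primitive_element_iff_minpoly_natDegree_eq ℚ a).1 ha
    have hmem : (integralBasis F j : F) ∈ Algebra.adjoin ℚ {a} := by
      rw [← IntermediateField.adjoin_simple_toSubalgebra_of_isAlgebraic hint.isAlgebraic, ha]
      trivial
    rw [Algebra.adjoin_singleton_eq_range_aeval] at hmem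
    obtain ⟨p, hp⟩ := hmem
    have hp' : aeval a (p %ₘ minpoly ℚ a) = integralBasis F j := by
      rw [← hp, aeval_modByMonic_eq_self_of_root (minpoly.aeval ℚ a)]; rfl
    have hlt : (p %ₘ minpoly ℚ a).natDegree < finrank ℚ F := by
      rw [← hdeg]
      refine natDegree_modByMonic_lt _ (minpoly.monic hint) fun h1 => ?_
      exact minpoly.ne_one ℚ a h1
    rw [aeval_eq_sum_range' hlt] at hp'
    exact ⟨fun i => (p %ₘ minpoly ℚ a).coeff i, by
      rw [← hp', ← Fin.sum_univ_eq_sum_range fun i => (p %ₘ minpoly ℚ a).coeff i • a ^ i]⟩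
  rw [hc, map_sum]
  refine Submodule.sum_mem _ fun i _ => ?_
  rw [map_rat_smul, ← Rat.cast_smul_eq_qsmul ℝ]
  exact Submodule.smul_mem _ _ (Submodule.subset_span ⟨i, rfl⟩)

/-- A radius, in terms of the degree `n` and the absolute discriminant `d`, such that the balls of
this radius around the integers of the field cover the whole Minkowski space. -/
def coveringRadius (n d : ℕ) : ℕ := n * (2 ^ n * (d + 1) + 1) ^ n

/-- Rounding the coordinates with respect to the powers of a primitive element. -/
theorem exists_integer_normAtPlace_sub_le (x : mixedSpace F) :
    ∃ b : 𝓞 F, ∀ w, normAtPlace w (x - mixedEmbedding F b) ≤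
      coveringRadius (finrank ℚ F) (discr F).natAbs := by
  obtain ⟨a, ha, hb⟩ := exists_primitive_element_le F
  have hx : x ∈ Submodule.span ℝ (Set.range fun i : Fin (finrank ℚ F) =>
      mixedEmbedding F ((a : F) ^ (i : ℕ))) := by
    rw [span_real_mixedEmbedding_pow_eq_top F ha]; trivial
  obtain ⟨c, hc⟩ := (Submodule.mem_span_range_iff_exists_fun ℝ).1 hx
  refine ⟨∑ i, ⌊c i⌋ • a ^ (i : ℕ), fun w => ?_⟩
  have hdiff : x - mixedEmbedding F ((∑ i, ⌊c i⌋ • a ^ (i : ℕ) : 𝓞 F) : F) =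
      ∑ i, Int.fract (c i) • mixedEmbedding F ((a : F) ^ (i : ℕ)) := by
    have hcoe : ((∑ i, ⌊c i⌋ • a ^ (i : ℕ) : 𝓞 F) : F) =
        ∑ i, ⌊c i⌋ • (a : F) ^ (i : ℕ) := by
      simp
    rw [← hc, hcoe, map_sum, ← Finset.sum_sub_distrib]
    refine Finset.sum_congr rfl fun i _ => ?_
    rw [Int.fract, sub_smul, Int.cast_smul_eq_zsmul, map_zsmul]
  set B : ℝ := 2 ^ finrank ℚ F * ((discr F).natAbs + 1) + 1 with hB
  have hB1 : 1 ≤ B := by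
    rw [hB]
    linarith [show (0 : ℝ) ≤ 2 ^ finrank ℚ F * ((discr F).natAbs + 1) by positivity]
  rw [hdiff]
  calc _ ≤ ∑ i, normAtPlace w (Int.fract (c i) • mixedEmbedding F ((a : F) ^ (i : ℕ))) :=
        Finset.le_sum_of_subadditive _ (map_zero _).le (normAtPlace_add_le w) _ _
    _ ≤ ∑ i : Fin (finrank ℚ F), B ^ finrank ℚ F := by
        refine Finset.sum_le_sum fun i _ => ?_
        rw [normAtPlace_smul, normAtPlace_apply, map_pow, abs_of_nonneg (Int.fract_nonneg _)]
        calc _ ≤ 1 * B ^ (i : ℕ) := by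
              gcongr
              · exact (Int.fract_lt_one _).le
              · exact hb w
          _ ≤ _ := by
              rw [one_mul]
              exact pow_le_pow_right₀ hB1 i.2.le
    _ = _ := by
        rw [Finset.sum_const, Finset.card_univ, Fintype.card_fin, nsmul_eq_mul, coveringRadius]
        push_cast
        rfl

open scoped Classical in
/-- Averaging the number of lattice points over the translates of the lattice: every translate has
at least as many points in the thickened set `S` as there are integers in `T`. -/
theorem card_mul_volume_fundamentalDomain_le (T : Finset (𝓞 F)) {S : Set (mixedSpace F)}
    (hS : MeasurableSet S)
    (hTS : ∀ a ∈ T, ∀ d : mixedSpace F,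
      (∀ w, normAtPlace w d ≤ coveringRadius (finrank ℚ F) (discr F).natAbs) →
        mixedEmbedding F a + d ∈ S) :
    T.card * volume (ZSpan.fundamentalDomain (latticeBasis F)) ≤ volume S := by
  set D := ZSpan.fundamentalDomain (latticeBasis F)
  have hD : IsAddFundamentalDomain (mixedEmbedding.integerLattice F).toAddSubgroup D volume :=
    fundamentalDomain_integerLattice F
  have : Countable (mixedEmbedding.integerLattice F).toAddSubgroup :=
    inferInstanceAs (Countable (mixedEmbedding.integerLattice F))
  have hmem : ∀ a : 𝓞 F, mixedEmbedding F a ∈ mixedEmbedding.integerLattice F := fun a =>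
    ⟨a, rfl⟩
  let e : 𝓞 F → (mixedEmbedding.integerLattice F).toAddSubgroup := fun a => ⟨mixedEmbedding F a, hmem a⟩
  have he : Function.Injective e := fun a b hab => by
    have := (mixedEmbedding_injective F) (Subtype.ext_iff.1 hab)
    exact RingOfIntegers.ext this
  have hsub : ∀ a b, ((e (a - b) : mixedSpace F)) = mixedEmbedding F a - mixedEmbedding F b :=
    fun a b => by simp [e]
  calc (T.card : ℝ≥0∞) * volume D = ∫⁻ x in D, (T.card : ℝ≥0∞) := by
        rw [setLIntegral_const]
    _ ≤ ∫⁻ x in D, ∑' g : (mixedEmbedding.integerLattice F).toAddSubgroup, S.indicator 1 (g +ᵥ x) := by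
        refine lintegral_mono fun x => ?_
        -- Translating by `a - b`, with `b` close to `x`, moves `x` close to `a`.
        obtain ⟨b, hb⟩ := exists_integer_normAtPlace_sub_le F x
        have hinj : Function.Injective fun a => e (a - b) := fun a a' h => by
          simpa using he h
        refine le_trans ?_ (ENNReal.sum_le_tsum (T.map ⟨_, hinj⟩))
        rw [Finset.sum_map, Finset.card_eq_sum_ones, Nat.cast_sum]
        refine Finset.sum_le_sum fun a ha => ?_
        have : (e (a - b)) +ᵥ x ∈ S := by
          convert hTS a ha _ hb using 1
          rw [AddSubgroup.vadd_def, vadd_eq_add, hsub]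
          abel
        simp only [Function.Embedding.coeFn_mk]
        rw [Set.indicator_of_mem this]
        simp
    _ = ∑' g : (mixedEmbedding.integerLattice F).toAddSubgroup, ∫⁻ x in D, S.indicator 1 (g +ᵥ x) := by
        refine lintegral_tsum fun g => Measurable.aemeasurable ?_
        exact (measurable_one.indicator hS).comp (measurable_const_vadd g)
    _ = ∫⁻ x, S.indicator 1 x := (hD.lintegral_eq_tsum'' _).symm
    _ = volume S := lintegral_indicator_one hS

end Covering

/-! ### Roots, conjugates and the Mahler measure -/

section Roots

open NumberField NumberField.InfinitePlace NumberField.mixedEmbedding Module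
open scoped IntermediateField ENNReal

variable {F : Type*} [Field F] [NumberField F] {P : ℤ[X]} {a : F}

theorem minpoly_eq_map_of_irreducible (hm : P.Monic) (hi : Irreducible (P.map (Int.castRingHom ℚ)))
    (ha : aeval a P = 0) : minpoly ℚ a = P.map (Int.castRingHom ℚ) := by
  refine (minpoly.eq_of_irreducible_of_monic hi ?_ (hm.map _)).symm
  rwa [← algebraMap_int_eq, aeval_map_algebraMap]

/-- The complex roots of the minimal polynomial of a primitive element are its conjugates. -/
theorem roots_map_eq_conjugates (hm : P.Monic) (hi : Irreducible (P.map (Int.castRingHom ℚ)))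
    (hd : P.natDegree = finrank ℚ F) (ha : aeval a P = 0) :
    (P.map (Int.castRingHom ℂ)).roots = (Finset.univ : Finset (F →+* ℂ)).val.map fun φ => φ a := by
  have hmin := minpoly_eq_map_of_irreducible hm hi ha
  have hprim : ℚ⟮a⟯ = ⊤ := by
    rw [Field.primitive_element_iff_minpoly_natDegree_eq, hmin, hm.natDegree_map, hd]
  have hinj : Function.Injective fun φ : F →+* ℂ => φ a := by
    have := (Field.primitive_element_iff_algHom_eq_of_eval' ℚ ℂ
      (fun x => IsAlgClosed.splits _) a).1 hprim
    intro φ ψ h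
    have h2 := @this φ.toRatAlgHom ψ.toRatAlgHom (by simpa using h)
    ext x
    simpa using DFunLike.congr_fun h2 x
  have hmapC : P.map (Int.castRingHom ℂ) = (minpoly ℚ a).map (algebraMap ℚ ℂ) := by
    rw [hmin, Polynomial.map_map]
    congr 1
  have hsep : (P.map (Int.castRingHom ℂ)).roots.Nodup := by
    rw [hmapC]
    exact nodup_roots (Polynomial.Separable.map (Algebra.IsSeparable.isSeparable ℚ a))
  refine (Multiset.Nodup.ext hsep (Finset.univ.nodup.map hinj)).2 fun z => ?_
  have hz := Set.ext_iff.1 (Embeddings.range_eval_eq_rootSet_minpoly F ℂ a) z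
  rw [mem_rootSet', ← eval_map_algebraMap, ← hmapC] at hz
  have hne : P.map (Int.castRingHom ℂ) ≠ 0 := (hm.map _).ne_zero
  rw [mem_roots hne, IsRoot.def]
  simpa [hne] using hz.symm

theorem prod_infinitePlace_pow_mult_eq_prod_roots (hm : P.Monic)
    (hi : Irreducible (P.map (Int.castRingHom ℚ)))
    (hd : P.natDegree = finrank ℚ F) (ha : aeval a P = 0) (f : ℝ → ℝ) :
    ∏ w : InfinitePlace F, f (w a) ^ w.mult =
      ((P.map (Int.castRingHom ℂ)).roots.map fun z => f ‖z‖).prod := by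
  classical
  rw [roots_map_eq_conjugates hm hi hd ha, Multiset.map_map]
  change _ = ∏ φ : F →+* ℂ, f ‖φ a‖
  rw [← Finset.prod_fiberwise Finset.univ InfinitePlace.mk (fun φ : F →+* ℂ => f ‖φ a‖)]
  refine Finset.prod_congr rfl fun w _ => ?_
  have (φ) (hφ : φ ∈ ({φ | mk φ = w} : Finset (F →+* ℂ))) : f ‖φ a‖ = f (w a) := by
    rw [← (Finset.mem_filter.mp hφ).2, apply]
  rw [Finset.prod_congr rfl this, Finset.prod_const, card_filter_mk_eq]

theorem natAbs_coeff_le_of_mem_monicBox {n H : ℕ} (hP : P ∈ monicBox n H) {i : ℕ} (hi : i < n) :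
    (P.coeff i).natAbs ≤ H :=
  (Finset.le_sup (f := fun i => (P.coeff i).natAbs)
    (Finset.mem_range.mpr (hP.2.1.symm ▸ hi))).trans hP.2.2

/-- Landau's inequality for the Mahler measure, in terms of the absolute values of a root. -/
theorem prod_max_one_le_sqrt_mul {H : ℕ} (hH : 1 ≤ H) (hP : P ∈ irrSet F (finrank ℚ F) H)
    (ha : aeval a P = 0) :
    ∏ w : InfinitePlace F, max 1 (w a) ^ w.mult ≤ √(finrank ℚ F + 1) * H := by
  obtain ⟨hbox, hi, -⟩ := hP
  obtain ⟨hm, hd, -⟩ := id hbox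
  rw [prod_infinitePlace_pow_mult_eq_prod_roots hm hi hd ha (fun x => max 1 x)]
  have h1 := mahlerMeasure_eq_leadingCoeff_mul_prod_roots (P.map (Int.castRingHom ℂ))
  rw [(hm.map _).leadingCoeff, norm_one, one_mul] at h1
  rw [← h1]
  refine (mahlerMeasure_le_sqrt_natDegree_add_one_mul_supNorm _).trans ?_
  rw [hm.natDegree_map, hd]
  gcongr
  obtain ⟨i, hi⟩ := exists_eq_supNorm (P.map (Int.castRingHom ℂ))
  rw [hi, coeff_map, eq_intCast, Complex.norm_intCast, ← Int.cast_abs, Int.abs_eq_natAbs,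
    Int.cast_natCast]
  norm_cast
  rcases lt_trichotomy i (finrank ℚ F) with h | h | h
  · exact natAbs_coeff_le_of_mem_monicBox hbox h
  · have : P.coeff i = 1 := by rw [h, ← hd]; exact hm
    rw [this]; exact hH
  · rw [coeff_eq_zero_of_natDegree_lt (by rwa [hd])]; simp

/-- If there is only one infinite place, the Mahler measure of a nonzero integer is its norm. -/
theorem prod_max_one_le_of_subsingleton [Subsingleton (InfinitePlace F)] {H : ℕ} (hH : 1 ≤ H)
    (hP : P ∈ irrSet F (finrank ℚ F) H) (ha : aeval a P = 0) :
    ∏ w : InfinitePlace F, max 1 (w a) ^ w.mult ≤ H := by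
  obtain ⟨hbox, hi, -⟩ := hP
  obtain ⟨hm, hd, -⟩ := id hbox
  have h1 := prod_infinitePlace_pow_mult_eq_prod_roots hm hi hd ha id
  have hsplit : (P.map (Int.castRingHom ℂ)).Splits := IsAlgClosed.splits _
  have h2 : ((P.map (Int.castRingHom ℂ)).roots.map fun z => ‖z‖).prod ≤ H := by
    have h3 := hsplit.coeff_zero_eq_prod_roots_of_monic (hm.map _)
    have h4 := congrArg (fun z => ‖z‖) h3
    simp only [norm_mul, norm_pow, norm_neg, norm_one, one_pow, one_mul] at h4
    have h5 : ‖(P.map (Int.castRingHom ℂ)).roots.prod‖ =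
        ((P.map (Int.castRingHom ℂ)).roots.map fun z => ‖z‖).prod :=
      map_multiset_prod (normHom : ℂ →*₀ ℝ) _
    rw [← h5, ← h4, coeff_map, eq_intCast, Complex.norm_intCast, ← Int.cast_abs,
      Int.abs_eq_natAbs, Int.cast_natCast]
    exact_mod_cast natAbs_coeff_le_of_mem_monicBox hbox finrank_pos
  obtain ⟨w₀⟩ : Nonempty (InfinitePlace F) := inferInstance
  rw [Fintype.prod_subsingleton _ w₀] at h1 ⊢
  have hH' : (1 : ℝ) ≤ H := by exact_mod_cast hH
  rcases le_total 1 (w₀ a) with h | h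
  · rw [max_eq_right h]
    exact h1.le.trans h2
  · rw [max_eq_left h, one_pow]; exact hH'

/-- A thickening of the region `∏ max(1, |x|_w) ^ m_w ≤ X` where the Mahler measure is at most `X`:
it contains all points at distance at most `r`, at every infinite place, from that region. -/
def mahlerRegion (F : Type*) [Field F] [NumberField F] (r X : ℝ) : Set (mixedSpace F) :=
  {x | ∏ w : InfinitePlace F, max 1 (normAtPlace w x - r) ^ w.mult ≤ X}

theorem measurableSet_mahlerRegion (r X : ℝ) : MeasurableSet (mahlerRegion F r X) := by
  refine (isClosed_le (continuous_finsetProd _ fun w _ => ?_) continuous_const).measurableSet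
  have := mixedEmbedding.continuous_normAtPlace (K := F) w
  fun_prop

open scoped Classical in
/-- Every polynomial in `irrSet F n H` is determined by any of its roots in `F`, an algebraic
integer of Mahler measure at most `X`. -/
theorem irrCount_mul_volume_le {H : ℕ} {X : ℝ}
    (hX : ∀ P ∈ irrSet F (finrank ℚ F) H, ∀ a : F, aeval a P = 0 →
      ∏ w : InfinitePlace F, max 1 (w a) ^ w.mult ≤ X) :
    irrCount F (finrank ℚ F) H * volume (ZSpan.fundamentalDomain (latticeBasis F)) ≤
      volume (mahlerRegion F (coveringRadius (finrank ℚ F) (discr F).natAbs) X) := by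
  have hroot : ∀ P : ℤ[X], ∃ a : 𝓞 F, P ∈ irrSet F (finrank ℚ F) H → aeval (a : F) P = 0 := by
    intro P
    by_cases hP : P ∈ irrSet F (finrank ℚ F) H
    · obtain ⟨a, ha⟩ := hP.2.2
      exact ⟨⟨a, P, hP.1.1, ha⟩, fun _ => ha⟩
    · exact ⟨0, fun h => absurd h hP⟩
  choose f hf using hroot
  set T := (irrSet_finite F (finrank ℚ F) H).toFinset with hT
  have hmemT : ∀ P, P ∈ T ↔ P ∈ irrSet F (finrank ℚ F) H := fun P => Set.Finite.mem_toFinset _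
  have hinj : Set.InjOn f T := by
    intro P hP Q hQ hPQ
    have hP' := (hmemT P).1 hP
    have hQ' := (hmemT Q).1 hQ
    have h1 := minpoly_eq_map_of_irreducible hP'.1.1 hP'.2.1 (hf P hP')
    have h2 := minpoly_eq_map_of_irreducible hQ'.1.1 hQ'.2.1 (hf Q hQ')
    rw [hPQ, h2] at h1
    exact (map_injective _ Int.cast_injective h1).symm
  have hcard : irrCount F (finrank ℚ F) H = (T.image f).card := by
    rw [Finset.card_image_of_injOn hinj, irrCount]
  rw [hcard]
  refine card_mul_volume_fundamentalDomain_le F _ (measurableSet_mahlerRegion _ _) ?_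
  intro a ha d hd
  obtain ⟨P, hP, rfl⟩ := Finset.mem_image.1 ha
  have hP' := (hmemT P).1 hP
  rw [mahlerRegion, Set.mem_ofPred_eq]
  refine le_trans ?_ (hX P hP' _ (hf P hP'))
  refine Finset.prod_le_prod (fun w _ => by positivity) fun w _ => ?_
  gcongr
  have := normAtPlace_add_le w (mixedEmbedding F (f P)) d
  rw [normAtPlace_apply] at this
  linarith [hd w]

end Roots

/-! ### The volume of the thickened Mahler region -/

section Volume

open NumberField NumberField.InfinitePlace NumberField.mixedEmbedding Module
open scoped ENNReal

theorem volume_real_max_one_sub_le {r y : ℝ} (hr : 0 ≤ r) (hy : 1 ≤ y) :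
    volume {x : ℝ | max 1 (‖x‖ - r) ≤ y} ≤ 2 * ENNReal.ofReal (y + (2 * r + r ^ 2) * √y) := by
  have hs : 1 ≤ √y := Real.one_le_sqrt.2 hy
  calc _ ≤ volume (Metric.closedBall (0 : ℝ) (y + r)) := by
        refine measure_mono fun x hx => ?_
        have := (max_le_iff.1 (Set.mem_ofPred_eq ▸ hx)).2
        rw [mem_closedBall_zero_iff]; linarith
    _ = 2 * ENNReal.ofReal (y + r) := by
        rw [Real.volume_closedBall, ENNReal.ofReal_mul zero_le_two, ENNReal.ofReal_ofNat]
    _ ≤ _ := by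
        gcongr
        nlinarith [mul_nonneg hr (sub_nonneg.2 hs), mul_nonneg (sq_nonneg r) (zero_le_one.trans hs)]

theorem volume_complex_max_one_sub_sq_le {r y : ℝ} (hr : 0 ≤ r) (hy : 1 ≤ y) :
    volume {z : ℂ | max 1 (‖z‖ - r) ^ 2 ≤ y} ≤
      ENNReal.ofReal Real.pi * ENNReal.ofReal (y + (2 * r + r ^ 2) * √y) := by
  have hs : 1 ≤ √y := Real.one_le_sqrt.2 hy
  have e : √y ^ 2 = y := Real.sq_sqrt (by linarith)
  calc _ ≤ volume (Metric.closedBall (0 : ℂ) (√y + r)) := by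
        refine measure_mono fun x hx => ?_
        have := (max_le_iff.1 (Real.le_sqrt_of_sq_le (Set.mem_ofPred_eq ▸ hx))).2
        rw [mem_closedBall_zero_iff]; linarith
    _ = ENNReal.ofReal Real.pi * ENNReal.ofReal ((√y + r) ^ 2) := by
        rw [Complex.volume_closedBall, mul_comm, ENNReal.ofReal_pow (by positivity)]
        congr 1
        exact (ENNReal.ofReal_coe_nnreal).symm
    _ ≤ _ := by
        gcongr
        nlinarith [mul_nonneg (sq_nonneg r) (sub_nonneg.2 hs)]

open scoped Classical in
/-- Two applications of the product bound, to the complex and then to the real coordinates. -/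
theorem volume_mahlerRegion_le (F : Type*) [Field F] [NumberField F] {r X : ℝ} (hr : 0 ≤ r) :
    volume (mahlerRegion F r X) ≤ 2 ^ nrRealPlaces F * ENNReal.ofReal Real.pi ^ nrComplexPlaces F *
      prodVolBound' (2 * r + r ^ 2) (Fintype.card (InfinitePlace F)) X := by
  set C := 2 * r + r ^ 2 with hC
  have hC0 : 0 ≤ C := by positivity
  let f : ℝ → ℝ := fun x => max 1 (‖x‖ - r)
  let g : ℂ → ℝ := fun z => max 1 (‖z‖ - r) ^ 2
  have hf : Measurable f := by fun_prop
  have hg : Measurable g := by fun_prop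
  have hf1 : ∀ x, 1 ≤ f x := fun x => le_max_left _ _
  have hg1 : ∀ z, 1 ≤ g z := fun z => one_le_pow₀ (le_max_left _ _)
  have hprod : ∀ x : mixedSpace F, ∏ w : InfinitePlace F, max 1 (normAtPlace w x - r) ^ w.mult =
      (∏ w, f (x.1 w)) * ∏ w, g (x.2 w) := by
    intro x
    rw [prod_eq_prod_mul_prod]
    congr 1
    · refine Finset.prod_congr rfl fun w _ => ?_
      rw [normAtPlace_apply_of_isReal w.2, mult_isReal, pow_one]
    · refine Finset.prod_congr rfl fun w _ => ?_
      rw [normAtPlace_apply_of_isComplex w.2, mult_isComplex]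
  have hsec : ∀ x : {w : InfinitePlace F // IsReal w} → ℝ,
      volume (Prod.mk x ⁻¹' mahlerRegion F r X) ≤
        ENNReal.ofReal Real.pi ^ nrComplexPlaces F *
          prodVolBound' C (nrComplexPlaces F) (X / ∏ w, f (x w)) := by
    intro x
    have hpos : 0 < ∏ w, f (x w) := Finset.prod_pos fun w _ => zero_lt_one.trans_le (hf1 _)
    have hlint := lintegral_pi_prodVolBound'_div_prod_le (volume : Measure ℂ) hg hg1 hC0
      (fun y hy => volume_complex_max_one_sub_sq_le hr hy)
      (κ := {w : InfinitePlace F // IsComplex w}) 0 (X / ∏ w, f (x w))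
    rw [zero_add] at hlint
    refine le_trans (le_of_eq ?_) hlint
    rw [← lintegral_indicator_one (measurable_prodMk_left (measurableSet_mahlerRegion r X)),
      volume_pi]
    refine lintegral_congr fun z => ?_
    have hzpos : 0 < ∏ w, g (z w) := Finset.prod_pos fun w _ => zero_lt_one.trans_le (hg1 _)
    have hiff : 1 ≤ X / (∏ w, f (x w)) / ∏ w, g (z w) ↔
        z ∈ Prod.mk x ⁻¹' mahlerRegion F r X := by
      rw [Set.mem_preimage, mahlerRegion, Set.mem_ofPred_eq, hprod, div_div,
        le_div_iff₀ (mul_pos hpos hzpos), one_mul]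
    by_cases hz : z ∈ Prod.mk x ⁻¹' mahlerRegion F r X
    · rw [Set.indicator_of_mem hz, prodVolBound', if_pos (hiff.2 hz)]
      simp [prodVolBound]
    · rw [Set.indicator_of_notMem hz, prodVolBound', if_neg (mt hiff.1 hz)]
  have hlint := lintegral_pi_prodVolBound'_div_prod_le (volume : Measure ℝ) hf hf1 hC0
      (fun y hy => volume_real_max_one_sub_le hr hy)
      (κ := {w : InfinitePlace F // IsReal w}) (nrComplexPlaces F) X
  calc volume (mahlerRegion F r X)
      = ∫⁻ x, volume (Prod.mk x ⁻¹' mahlerRegion F r X) ∂volume := by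
        rw [Measure.volume_eq_prod, Measure.prod_apply (measurableSet_mahlerRegion r X)]
    _ ≤ ∫⁻ x : {w : InfinitePlace F // IsReal w} → ℝ, ENNReal.ofReal Real.pi ^ nrComplexPlaces F *
          prodVolBound' C (nrComplexPlaces F) (X / ∏ w, f (x w)) := lintegral_mono hsec
    _ = ENNReal.ofReal Real.pi ^ nrComplexPlaces F *
          ∫⁻ x : {w : InfinitePlace F // IsReal w} → ℝ,
            prodVolBound' C (nrComplexPlaces F) (X / ∏ w, f (x w)) := by
        refine lintegral_const_mul _ ((measurable_prodVolBound' _ _).comp ?_)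
        fun_prop
    _ ≤ _ := by
        rw [volume_pi, card_eq_nrRealPlaces_add_nrComplexPlaces, mul_comm (2 ^ _), mul_assoc,
          add_comm (nrRealPlaces F)]
        gcongr

end Volume

/-! ### Constants and the final comparison -/

section Constants

/-- The coefficient of the secondary terms in the volume bounds attached to the covering radius. -/
def thickeningConst (n d : ℕ) : ℕ := 2 * coveringRadius n d + coveringRadius n d ^ 2

/-- The additive constant to be compared with `log (2H)`. -/
def logShift (n d : ℕ) : ℕ := n + (1 + 5 * thickeningConst n d + 2 * thickeningConst n d ^ 2)

/-- The constant of the error term. The first summand serves the fields with a single infinite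
place. The second one bounds the number of polynomials of height `H` for all `H` in the range
`log (2H) < 8 * n * logShift n d`, where the asymptotic comparison is not available. -/
def errorConst (n d : ℕ) : ℕ := 7 * thickeningConst n d + 3 ^ ((8 * n * logShift n d + 1) * n)

theorem primrec₂_coveringRadius : Primrec₂ coveringRadius := by
  have hpow : Primrec₂ ((· ^ ·) : ℕ → ℕ → ℕ) := Primrec₂.unpaired'.1 Nat.Primrec.pow
  have hn : Primrec fun p : ℕ × ℕ => p.1 := Primrec.fst
  have hd : Primrec fun p : ℕ × ℕ => p.2 := Primrec.snd
  refine Primrec.nat_mul.comp hn (hpow.comp (Primrec.nat_add.comp (Primrec.nat_mul.comp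
    (hpow.comp (Primrec.const 2) hn) (Primrec.nat_add.comp hd (Primrec.const 1)))
    (Primrec.const 1)) hn)

theorem primrec₂_thickeningConst : Primrec₂ thickeningConst := by
  have hpow : Primrec₂ ((· ^ ·) : ℕ → ℕ → ℕ) := Primrec₂.unpaired'.1 Nat.Primrec.pow
  exact Primrec.nat_add.comp (Primrec.nat_mul.comp (Primrec.const 2) primrec₂_coveringRadius)
    (hpow.comp primrec₂_coveringRadius (Primrec.const 2))

theorem primrec₂_logShift : Primrec₂ logShift := by
  have hpow : Primrec₂ ((· ^ ·) : ℕ → ℕ → ℕ) := Primrec₂.unpaired'.1 Nat.Primrec.pow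
  have hC := primrec₂_thickeningConst
  exact Primrec.nat_add.comp Primrec.fst (Primrec.nat_add.comp (Primrec.nat_add.comp
    (Primrec.const 1) (Primrec.nat_mul.comp (Primrec.const 5) hC))
    (Primrec.nat_mul.comp (Primrec.const 2) (hpow.comp hC (Primrec.const 2))))

theorem primrec₂_errorConst : Primrec₂ errorConst := by
  have hpow : Primrec₂ ((· ^ ·) : ℕ → ℕ → ℕ) := Primrec₂.unpaired'.1 Nat.Primrec.pow
  have hn : Primrec fun p : ℕ × ℕ => p.1 := Primrec.fst
  exact Primrec.nat_add.comp (Primrec.nat_mul.comp (Primrec.const 7) primrec₂_thickeningConst)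
    (hpow.comp (Primrec.const 3) (Primrec.nat_mul.comp (Primrec.nat_add.comp
      (Primrec.nat_mul.comp (Primrec.nat_mul.comp (Primrec.const 8) hn) primrec₂_logShift)
      (Primrec.const 1)) hn))

/-- Multiplying `n` by the factors `2, …, r` of `r!`, each of which is at most `n`. -/
theorem mul_factorial_le_pow {n r : ℕ} (hr : 1 ≤ r) (hrn : r ≤ n) : n * r.factorial ≤ n ^ r := by
  induction r, hr using Nat.le_induction with
  | base => simp
  | succ r hr ih =>
    calc n * (r + 1).factorial = (r + 1) * (n * r.factorial) := by
          rw [Nat.factorial_succ]; ring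
      _ ≤ n * n ^ r := Nat.mul_le_mul hrn (ih (by omega))
      _ = n ^ (r + 1) := by ring

/-- The comparison of main terms: the volume `(n L) ^ r / r!` of the simplex exceeds `n * L ^ r`,
and `n > √(n + 1)` leaves room for replacing `L` by `L + b` when `L` is large. -/
theorem sqrt_mul_pow_le_pow_div_factorial {n r : ℕ} (hn : 2 ≤ n) (hr : 1 ≤ r) (hrn : r ≤ n)
    {L b u : ℝ} (hb : 0 ≤ b) (hL : 8 * n * b ≤ L) (hu0 : 0 ≤ u) (hu : u ≤ L + b) :
    √(n + 1) * u ^ r ≤ (n * L) ^ r / r.factorial := by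
  have hn' : (2 : ℝ) ≤ n := by exact_mod_cast hn
  have hL0 : 0 ≤ L := le_trans (by positivity) hL
  have hu1 : u ≤ L * Real.exp (1 / (8 * n)) := by
    have h1 : b ≤ L * (1 / (8 * n)) := by
      rw [mul_one_div, le_div_iff₀ (by positivity)]; linarith
    have h2 := mul_le_mul_of_nonneg_left (Real.add_one_le_exp (1 / (8 * (n : ℝ)))) hL0
    linarith
  have hu2 : u ^ r ≤ L ^ r * Real.exp (1 / 8) := by
    calc u ^ r ≤ (L * Real.exp (1 / (8 * n))) ^ r := pow_le_pow_left₀ hu0 hu1 r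
      _ = L ^ r * Real.exp (r * (1 / (8 * n))) := by rw [mul_pow, ← Real.exp_nat_mul]
      _ ≤ L ^ r * Real.exp (1 / 8) := by
        gcongr
        have : (r : ℝ) ≤ n := by exact_mod_cast hrn
        rw [mul_one_div, div_le_div_iff₀ (by positivity) (by positivity)]
        linarith
  -- `(n + 1) * 4 / 3 ≤ n ^ 2` is `(3 * n + 2) * (n - 2) ≥ 0`.
  have hexp : Real.exp (1 / 8) ^ 2 ≤ 4 / 3 := by
    rw [← Real.exp_nat_mul]
    refine le_of_pow_le_pow_left₀ (n := 4) (by norm_num) (by norm_num) ?_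
    rw [← Real.exp_nat_mul]
    norm_num
    linarith [Real.exp_one_lt_d9]
  have hsq : √(n + 1) * Real.exp (1 / 8) ≤ n := by
    refine le_of_pow_le_pow_left₀ (n := 2) (by norm_num) (by positivity) ?_
    rw [mul_pow, Real.sq_sqrt (by positivity)]
    nlinarith [mul_le_mul_of_nonneg_left hexp (show (0 : ℝ) ≤ n + 1 by positivity)]
  calc √(n + 1) * u ^ r ≤ √(n + 1) * (L ^ r * Real.exp (1 / 8)) := by gcongr
    _ = (√(n + 1) * Real.exp (1 / 8)) * L ^ r := by ring
    _ ≤ n * L ^ r := by gcongr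
    _ ≤ (n * L) ^ r / r.factorial := by
      rw [le_div_iff₀ (by positivity), mul_pow]
      have : (n : ℝ) * r.factorial ≤ n ^ r := by exact_mod_cast mul_factorial_le_pow hr hrn
      nlinarith [pow_nonneg hL0 r]

end Constants

section Count

open NumberField NumberField.InfinitePlace NumberField.Units NumberField.mixedEmbedding Module
open scoped ENNReal

theorem irrCount_le_pow (K : Type*) [Field K] [NumberField K] (n H : ℕ) :
    irrCount K n H ≤ (2 * H + 1) ^ n := by
  classical
  set S : Finset (Fin n → ℤ) := Fintype.piFinset fun _ => Finset.Icc (-(H : ℤ)) H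
  have hS : S.card = (2 * H + 1) ^ n := by
    rw [Fintype.card_piFinset]
    simp only [Int.card_Icc, Finset.prod_const, Finset.card_univ, Fintype.card_fin]
    congr 1
    omega
  rw [irrCount, ← hS]
  refine Finset.card_le_card_of_injOn (fun P i => P.coeff i) ?_ ?_
  · intro P hP
    have hP' := ((irrSet_finite K n H).mem_toFinset.1 hP).1
    refine Fintype.mem_piFinset.2 fun i => Finset.mem_Icc.2 ?_
    have := natAbs_coeff_le_of_mem_monicBox hP' i.2
    change -(H : ℤ) ≤ P.coeff i ∧ P.coeff i ≤ H
    omega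
  · intro P hP Q hQ hPQ
    have hP' := ((irrSet_finite K n H).mem_toFinset.1 hP).1
    have hQ' := ((irrSet_finite K n H).mem_toFinset.1 hQ).1
    ext i
    rcases lt_trichotomy i n with h | h | h
    · exact congrFun hPQ ⟨i, h⟩
    · have h1 : P.coeff i = 1 := by rw [h, ← hP'.2.1]; exact hP'.1
      have h2 : Q.coeff i = 1 := by rw [h, ← hQ'.2.1]; exact hQ'.1
      rw [h1, h2]
    · rw [coeff_eq_zero_of_natDegree_lt (by rwa [hP'.2.1]),
        coeff_eq_zero_of_natDegree_lt (by rwa [hQ'.2.1])]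

variable (F : Type*) [Field F] [NumberField F]

/-- The number `2 ^ r₁ * (2π) ^ r₂ / √|D|`: the volume `2 ^ r₁ * π ^ r₂` of the product of the unit
balls at the infinite places, divided by the covolume `2 ^ (-r₂) * √|D|` of the integers. -/
noncomputable def latticeDensity : ℝ :=
  2 ^ nrRealPlaces F * (2 * Real.pi) ^ nrComplexPlaces F / √|discr F|

theorem latticeDensity_nonneg : 0 ≤ latticeDensity F := by
  unfold latticeDensity; positivity

/-- The lattice-point count, with the covolume `2 ^ (-r₂) * √|D|` of the integers inserted. -/
theorem irrCount_le_latticeDensity_mul {H : ℕ} {X : ℝ} (hX1 : 1 ≤ X)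
    (hX : ∀ P ∈ irrSet F (finrank ℚ F) H, ∀ a : F, aeval a P = 0 →
      ∏ w : InfinitePlace F, max 1 (w a) ^ w.mult ≤ X) :
    (irrCount F (finrank ℚ F) H : ℝ) ≤ latticeDensity F *
      prodVolBound (thickeningConst (finrank ℚ F) (discr F).natAbs)
        (Fintype.card (InfinitePlace F)) X := by
  classical
  set d := (discr F).natAbs
  set n := finrank ℚ F
  set B := prodVolBound (thickeningConst n d) (Fintype.card (InfinitePlace F)) X with hB
  have hB0 : 0 ≤ B := by
    have hlog := Real.log_nonneg hX1
    match h : Fintype.card (InfinitePlace F) with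
    | 0 => rw [hB, h]; simp [prodVolBound]
    | 1 => rw [hB, h]; unfold prodVolBound; positivity
    | k + 2 => rw [hB, h]; unfold prodVolBound; positivity
  have h1 := (irrCount_mul_volume_le hX).trans
    (volume_mahlerRegion_le F (Nat.cast_nonneg (coveringRadius n d)))
  have hC : (2 * (coveringRadius n d : ℝ) + (coveringRadius n d : ℝ) ^ 2) =
      thickeningConst n d := by
    rw [thickeningConst]; push_cast; rfl
  rw [hC, prodVolBound', if_pos hX1, ← hB, volume_fundamentalDomain_latticeBasis] at h1
  have h2 := ENNReal.toReal_mono (by finiteness) h1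
  simp only [ENNReal.toReal_mul, ENNReal.toReal_pow, ENNReal.toReal_natCast, ENNReal.toReal_inv,
    ENNReal.toReal_ofNat, ENNReal.coe_toReal, Real.coe_sqrt, coe_nnnorm,
    ENNReal.toReal_ofReal Real.pi_pos.le, ENNReal.toReal_ofReal hB0, Int.norm_eq_abs] at h2
  have hD : 0 < √|(discr F : ℝ)| :=
    Real.sqrt_pos.2 (abs_pos.2 (Int.cast_ne_zero.2 (discr_ne_zero F)))
  have e : latticeDensity F * B = (2 ^ nrRealPlaces F * Real.pi ^ nrComplexPlaces F * B) *
      (2 ^ nrComplexPlaces F / √|(discr F : ℝ)|) := by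
    rw [latticeDensity, mul_pow]; ring
  rw [e]
  calc (irrCount F n H : ℝ) = irrCount F n H * ((2 : ℝ)⁻¹ ^ nrComplexPlaces F *
        √|(discr F : ℝ)|) * (2 ^ nrComplexPlaces F / √|(discr F : ℝ)|) := by
        rw [inv_pow]
        field_simp
    _ ≤ _ := by gcongr

/-- In the product of the residue and of `w / R` the regulator and the torsion cancel; dropping
the class number leaves the density of the lattice of integers. -/
theorem latticeDensity_le_residue_mul : latticeDensity F ≤
    dedekindZeta_residue F * ((torsionOrder F : ℝ) / regulator F) := by
  have hR := regulator_pos F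
  have hw : (0 : ℝ) < torsionOrder F := Nat.cast_pos.2 (torsionOrder_pos F)
  have hh : (1 : ℝ) ≤ classNumber F := by exact_mod_cast classNumber_pos F
  have e : dedekindZeta_residue F * ((torsionOrder F : ℝ) / regulator F) =
      latticeDensity F * classNumber F := by
    rw [dedekindZeta_residue_def, latticeDensity]
    field_simp
  rw [e]
  exact le_mul_of_one_le_right (latticeDensity_nonneg F) hh

/-- The part of the right-hand side that is used in the comparison: the product of the main terms,
and the error term times `1`. -/
theorem latticeDensity_mul_add_le {H : ℕ} (hH : 1 ≤ H) {E : ℝ} (hE : 0 ≤ E) :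
    latticeDensity F * (H * ((finrank ℚ F * Real.log (2 * H)) ^ rank F / (rank F).factorial)) + E ≤
      (dedekindZeta_residue F * (H : ℝ) + E) *
        ((torsionOrder F : ℝ) / regulator F * logRegionVolume F H + 1) := by
  have hV := le_logRegionVolume F hH
  have hV0 : 0 ≤ logRegionVolume F H := measureReal_nonneg
  have hκ := (dedekindZeta_residue_pos F).le
  have hR := regulator_pos F
  have h1 : latticeDensity F *
      (H * ((finrank ℚ F * Real.log (2 * H)) ^ rank F / (rank F).factorial)) ≤
      dedekindZeta_residue F * ((torsionOrder F : ℝ) / regulator F) *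
        (H * logRegionVolume F H) := by
    refine mul_le_mul (latticeDensity_le_residue_mul F) (by gcongr) ?_ (by positivity)
    have : 0 ≤ Real.log (2 * H) := by
      have : (1 : ℝ) ≤ H := by exact_mod_cast hH
      exact Real.log_nonneg (by linarith)
    positivity
  have h2 : 0 ≤ E * ((torsionOrder F : ℝ) / regulator F * logRegionVolume F H) := by positivity
  have h3 : 0 ≤ dedekindZeta_residue F * (H : ℝ) := by positivity
  nlinarith

/-- The bound for the contribution of one field of degree `n`. -/
theorem irrCount_le_of_finrank {n : ℕ} (hn : 2 ≤ n) (hF : finrank ℚ F = n) {H : ℕ} (hH : 1 ≤ H) :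
    (irrCount F n H : ℝ) ≤
      (dedekindZeta_residue F * (H : ℝ) +
          (errorConst n (discr F).natAbs : ℝ) * (H : ℝ) ^ (1 - 1 / (n : ℝ))) *
        ((torsionOrder F : ℝ) / regulator F * logRegionVolume F H + 1) := by
  subst hF
  set n := finrank ℚ F with hn_def
  set d := (discr F).natAbs
  have hH' : (1 : ℝ) ≤ H := by exact_mod_cast hH
  have hn' : (2 : ℝ) ≤ n := by exact_mod_cast hn
  have hexp : (0 : ℝ) ≤ 1 - 1 / n := by
    rw [sub_nonneg, div_le_one (by linarith)]; linarith
  have hHp : 1 ≤ (H : ℝ) ^ (1 - 1 / (n : ℝ)) := Real.one_le_rpow hH' hexp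
  set E : ℝ := (errorConst n d : ℝ) * (H : ℝ) ^ (1 - 1 / (n : ℝ)) with hE
  have hE0 : 0 ≤ E := by positivity
  refine le_trans ?_ (latticeDensity_mul_add_le F hH hE0)
  have hM := latticeDensity_nonneg F
  have hcard : Fintype.card (InfinitePlace F) = rank F + 1 := by
    rw [rank]; have := Fintype.card_pos (α := InfinitePlace F); omega
  have hL0 : 0 ≤ Real.log (2 * H) := Real.log_nonneg (by linarith)
  rcases Nat.eq_zero_or_pos (rank F) with hr | hr
  -- A single infinite place: `F` is imaginary quadratic and the exponent `1 - 1 / n` is `1 / 2`.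
  · have hsub : Subsingleton (InfinitePlace F) :=
      Fintype.card_le_one_iff_subsingleton.1 (by rw [hcard, hr])
    have h1 := irrCount_le_latticeDensity_mul F hH'
      fun P hP a ha => prod_max_one_le_of_subsingleton hH hP ha
    rw [hcard, hr, zero_add, prodVolBound] at h1
    have hn2 : n = 2 := by
      refine le_antisymm ?_ hn
      obtain ⟨w₀⟩ : Nonempty (InfinitePlace F) := inferInstance
      rw [hn_def, ← sum_mult_eq, Fintype.sum_subsingleton _ w₀, mult]
      split_ifs <;> norm_num
    have hMle : latticeDensity F ≤ 7 := by
      have hsum : nrRealPlaces F + nrComplexPlaces F = 1 := by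
        rw [← card_eq_nrRealPlaces_add_nrComplexPlaces, hcard, hr]
      have hD : 1 ≤ √|(discr F : ℝ)| := by
        rw [Real.one_le_sqrt]
        exact_mod_cast Int.one_le_abs (discr_ne_zero F)
      have hpi := Real.pi_gt_three
      have hpi' := Real.pi_lt_d2
      rw [latticeDensity, div_le_iff₀ (by linarith)]
      calc (2 : ℝ) ^ nrRealPlaces F * (2 * Real.pi) ^ nrComplexPlaces F
          ≤ (2 * Real.pi) ^ nrRealPlaces F * (2 * Real.pi) ^ nrComplexPlaces F := by
            gcongr; linarith
        _ = 2 * Real.pi := by rw [← pow_add, hsum, pow_one]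
        _ ≤ 7 * √|(discr F : ℝ)| := by nlinarith
    have hsqrt : (H : ℝ) ^ (1 - 1 / (n : ℝ)) = √H := by
      rw [hn2, Real.sqrt_eq_rpow]; norm_num
    have hE' : 7 * (thickeningConst n d : ℝ) * √H ≤ E := by
      rw [hE, hsqrt]
      gcongr
      rw [errorConst]
      push_cast
      linarith [show (0 : ℝ) ≤ 3 ^ ((8 * n * logShift n d + 1) * n) by positivity]
    rw [hr]
    simp only [pow_zero, Nat.factorial_zero, Nat.cast_one, div_one, mul_one]
    have h2 : latticeDensity F * ((thickeningConst n d : ℝ) * √H) ≤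
        7 * ((thickeningConst n d : ℝ) * √H) := by gcongr
    linarith
  · rcases le_or_gt (8 * n * (logShift n d : ℝ)) (Real.log (2 * H)) with hbig | hsmall
    · have hs1 : 1 ≤ √((n : ℝ) + 1) := Real.one_le_sqrt.2 (by linarith)
      have hX1 : 1 ≤ √((n : ℝ) + 1) * H := one_le_mul_of_one_le_of_one_le hs1 hH'
      have h1 := irrCount_le_latticeDensity_mul F hX1
        fun P hP a ha => prod_max_one_le_sqrt_mul hH hP ha
      obtain ⟨k, hk⟩ : ∃ k, rank F = k + 1 := ⟨rank F - 1, by omega⟩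
      rw [hcard, hk] at h1
      simp only [prodVolBound] at h1
      refine h1.trans ((mul_le_mul_of_nonneg_left ?_ hM).trans (le_add_of_nonneg_right hE0))
      rw [hk, mul_comm (√_) (H : ℝ), mul_assoc]
      refine mul_le_mul_of_nonneg_left ?_ (by positivity)
      have hrn : k + 1 ≤ n := by
        have : Fintype.card (InfinitePlace F) ≤ n := by
          rw [hn_def, ← sum_mult_eq, Fintype.card_eq_sum_ones]
          exact Finset.sum_le_sum fun w _ => w.mult_pos
        omega
      refine sqrt_mul_pow_le_pow_div_factorial hn (by omega) hrn (Nat.cast_nonneg _) hbig ?_ ?_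
      · have := Real.log_nonneg hX1
        rw [mul_comm] at this
        positivity
      · have hlog1 : Real.log √((n : ℝ) + 1) ≤ n := by
          rw [Real.log_sqrt (by positivity)]
          have := Real.log_le_sub_one_of_pos (show (0 : ℝ) < n + 1 by positivity)
          linarith
        have hlog2 : Real.log H ≤ Real.log (2 * H) := Real.log_le_log (by linarith) (by linarith)
        rw [Real.log_mul (by positivity) (by positivity), logShift]
        push_cast
        linarith
    · refine le_trans ?_ (le_add_of_nonneg_left ?_)
      · have hHle : (H : ℝ) ≤ 3 ^ (8 * n * logShift n d) := by
          have h1 : 2 * (H : ℝ) < Real.exp (8 * n * (logShift n d : ℝ)) :=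
            (Real.log_lt_iff_lt_exp (by linarith)).1 hsmall
          have h2 : Real.exp (8 * n * (logShift n d : ℝ)) ≤ 3 ^ (8 * n * logShift n d) := by
            have : (8 * n * (logShift n d : ℝ)) = ((8 * n * logShift n d : ℕ) : ℝ) * 1 := by
              push_cast; ring
            rw [this, Real.exp_nat_mul]
            gcongr
            linarith [Real.exp_one_lt_d9]
          linarith
        calc (irrCount F n H : ℝ) ≤ (2 * H + 1) ^ n := by exact_mod_cast irrCount_le_pow F n H
          _ ≤ (3 ^ (8 * n * logShift n d + 1)) ^ n := by
            gcongr
            rw [pow_succ]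
            linarith
          _ = 3 ^ ((8 * n * logShift n d + 1) * n) := by rw [← pow_mul]
          _ ≤ (errorConst n d : ℝ) := by
            rw [errorConst]
            push_cast
            exact le_add_of_nonneg_left (by positivity)
          _ ≤ E := le_mul_of_one_le_right (Nat.cast_nonneg _) hHp
      · positivity

open scoped IntermediateField in
/-- A root in `K` of an irreducible polynomial of degree `n` generates a subfield of degree `n`. -/
theorem irrCount_le_sum_subfields (K : Type*) [Field K] [NumberField K] (n H : ℕ) :
    irrCount K n H ≤ ∑ L ∈ subfieldsOfDegree K n, irrCount L n H := by
  classical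
  refine le_trans (Finset.card_le_card ?_) (Finset.card_biUnion_le (s := subfieldsOfDegree K n)
    (t := fun L => (irrSet_finite L n H).toFinset))
  intro P hP
  obtain ⟨hbox, hi, x, hx⟩ := (irrSet_finite K n H).mem_toFinset.1 hP
  have hmin := minpoly_eq_map_of_irreducible hbox.1 hi hx
  refine Finset.mem_biUnion.2 ⟨ℚ⟮x⟯, ?_, ?_⟩
  · refine (subfieldsOfDegree_finite K n).mem_toFinset.2 ?_
    rw [Set.mem_ofPred_eq, IntermediateField.adjoin.finrank (.of_finite ℚ x), hmin,
      hbox.1.natDegree_map, hbox.2.1]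
  · refine (irrSet_finite _ n H).mem_toFinset.2 ⟨hbox, hi,
      IntermediateField.AdjoinSimple.gen ℚ x, ?_⟩
    apply FaithfulSMul.algebraMap_injective ℚ⟮x⟯ K
    rw [map_zero, ← aeval_algebraMap_apply, IntermediateField.AdjoinSimple.algebraMap_gen, hx]

end Count

theorem mainTheorem4 :
    ∃ c₁ c₂ : ℕ → ℕ → ℕ, Computable₂ c₁ ∧ Computable₂ c₂ ∧
      ∀ (n : ℕ), 2 ≤ n → ∀ (K : Type*) [Field K] [NumberField K],
        (subfieldsOfDegree K n).Nonempty →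
        ∀ H : ℕ, 1 ≤ H →
          (irrCount K n H : ℝ) ≤
            ∑ F ∈ subfieldsOfDegree K n,
              (NumberField.dedekindZeta_residue F * (H : ℝ) +
                  (c₁ n (NumberField.discr F).natAbs : ℝ) * (H : ℝ) ^ (1 - 1 / (n : ℝ))) *
                ((NumberField.Units.torsionOrder F : ℝ) / NumberField.Units.regulator F *
                    logRegionVolume F H +
                  (c₂ n (NumberField.discr F).natAbs : ℝ)) := by
  refine ⟨errorConst, fun _ _ => 1, primrec₂_errorConst.to_comp, (Primrec₂.const 1).to_comp, ?_⟩
  intro n hn K _ _ _ H hH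
  calc (irrCount K n H : ℝ) ≤ ∑ F ∈ subfieldsOfDegree K n, (irrCount F n H : ℝ) := by
        exact_mod_cast irrCount_le_sum_subfields K n H
    _ ≤ _ := by
        refine Finset.sum_le_sum fun F hF => ?_
        have hF' : Module.finrank ℚ F = n := (subfieldsOfDegree_finite K n).mem_toFinset.1 hF
        rw [Nat.cast_one]
        exact irrCount_le_of_finrank F hn hF' hH
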